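/- Let $h$ be the Klein metric on the unit disk $\mathbb D^2\subset\mathbb R^2$, with norm $$\Phi(\mathbf y)=\sqrt{h(\mathbf y,\mathbf y)}=\frac{\sqrt{u^2+v^2-(xv-yu)^2}}{1-x^2-y^2},\qquad \mathbf y=(u,v)\in T_{(x,y)}\mathbb D^2,$$ let $\mathbf v_{(x,y)}=(-y,x)$ be the rotation field, let $\epsilon\in\mathbb R$ and let $\mathbb D^2(\rho)$ be the open disk of radius $\rho=1/\sqrt{1+\epsilon^2}$ centred at the origin. For every $p\in\mathbb D^2(\rho)$ and $0\neq\mathbf y\in T_p\mathbb D^2(\rho)$ the equation $\Phi\big(\mathbf y/F(\mathbf y)-\epsilon\mathbf v_p\big)=1$ has exactly one positive solution $F(\mathbf y)$. It is $F=\alpha+\beta$ with $$\alpha(\mathbf y)=\frac{\sqrt{\epsilon^2h(\mathbf v,\mathbf y)^2+h(\mathbf y,\mathbf y)\big(1-\epsilon^2h(\mathbf v,\mathbf v)\big)}}{1-\epsilon^2h(\mathbf v,\mathbf v)},\qquad \beta(\mathbf y)=-\frac{\epsilon\,h(\mathbf v,\mathbf y)}{1-\epsilon^2h(\mathbf v,\mathbf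 v)} .$$ With $F(0)=0$, $F$ is a Finsler metric on $\mathbb D^2(\rho)$, and it is a Randers metric: $\alpha$ is the norm of a smooth Riemannian metric and $\beta$ is a smooth 1-form with $\sup_{\mathbf y\ne0}\beta(\mathbf y)/\alpha(\mathbf y)<1$ at each point. Moreover: (a) $F$ has constant flag curvature $\mathbf K=-1$, that is, $R^i_{\ k}=-\{F^2\delta^i_k-FF_{y^k}y^i\}$, where $R^i_{\ k}$ is the Riemann curvature of $F$. (b) The S-curvature of $F$, taken with respect to its Busemann-Hausdorff volume form, vanishes: $\mathbf S=0$. (c) If $\epsilon\neq0$, then $F$ is not locally projectively flat; that is, it is not true that every point of $\mathbb D^2(\rho)$ has a smooth local coordinate system around it in which the geodesics of $F$ are straight lines as point sets. (d) If $\epsilon\ne0$, then the Gauss curvature $\bar{\mathbf K}$ of $\alpha$ is not constant on $\mathbb D^2(\rho)$. If $\epsilon=0$, then $\bar{\mathbf K}=-1$. -/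

import Mathlib

open scoped ContDiff

noncomputable section

namespace Finsler

/-- Coordinate space `ℝⁿ`, with its Euclidean norm. -/
abbrev Coord (n : ℕ) : Type := EuclideanSpace ℝ (Fin n)

variable {n : ℕ}

/-- The coordinate vector `e i`. -/
def e (i : Fin n) : Coord n := EuclideanSpace.single i 1

/-- The partial derivative of `f` at `x` in the `i`-th coordinate. -/
def pd (f : Coord n → ℝ) (i : Fin n) (x : Coord n) : ℝ := fderiv ℝ f x (e i)

/-- The fundamental tensor: half the Hessian of `F ^ 2` in the vector variable `y`. -/
def fundTensor (F : Coord n → Coord n → ℝ) (x y : Coord n) : Matrix (Fin n) (Fin n) ℝ :=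
  Matrix.of fun i j => (1 / 2) * pd (fun z => pd (fun w => F x w ^ 2) i z) j y

/-- `F` is a Finsler metric on the open set `U` of `ℝⁿ`. -/
structure IsFinslerOn (U : Set (Coord n)) (F : Coord n → Coord n → ℝ) : Prop where
  smooth : ContDiffOn ℝ ∞ (fun z : Coord n × Coord n => F z.1 z.2) (U ×ˢ {y | y ≠ 0})
  zero : ∀ x ∈ U, F x 0 = 0
  pos : ∀ x ∈ U, ∀ y, y ≠ 0 → 0 < F x y
  homog : ∀ x ∈ U, ∀ y, ∀ t : ℝ, 0 < t → F x (t • y) = t * F x y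
  convex : ∀ x ∈ U, ∀ y, y ≠ 0 → ∀ u : Coord n, u ≠ 0 →
    0 < ∑ i, ∑ j, fundTensor F x y i j * u i * u j

/-- The geodesic (spray) coefficients
`G^i = (1/4) g^{ik} (2 ∂g_{pk}/∂x^q - ∂g_{pq}/∂x^k) y^p y^q`. -/
def spray (F : Coord n → Coord n → ℝ) (x y : Coord n) (i : Fin n) : ℝ :=
  (1 / 4) * ∑ k, (fundTensor F x y)⁻¹ i k * ∑ p, ∑ q,
    (2 * pd (fun x' => fundTensor F x' y p k) q x - pd (fun x' => fundTensor F x' y p q) k x)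
      * y p * y q

/-- The Riemann curvature
`R^i_k = 2 ∂G^i/∂x^k - y^j ∂²G^i/∂x^j∂y^k + 2 G^j ∂²G^i/∂y^j∂y^k - ∂G^i/∂y^j ∂G^j/∂y^k`. -/
def riemCurv (F : Coord n → Coord n → ℝ) (x y : Coord n) (i k : Fin n) : ℝ :=
  2 * pd (fun x' => spray F x' y i) k x
    - ∑ j, y j * pd (fun x' => pd (fun y' => spray F x' y' i) k y) j x
    + 2 * ∑ j, spray F x y j * pd (fun z => pd (fun w => spray F x w i) k z) j y
    - ∑ j, pd (fun w => spray F x w i) j y * pd (fun w => spray F x w j) k y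

/-- `F` has constant (flag) curvature `K` on `U`:
`R^i_k = K (F² δ^i_k - F F_{y^k} y^i)` for all non-zero tangent vectors over `U`. -/
def HasConstCurvatureOn (U : Set (Coord n)) (F : Coord n → Coord n → ℝ) (K : ℝ) : Prop :=
  ∀ x ∈ U, ∀ y, y ≠ 0 → ∀ i k : Fin n,
    riemCurv F x y i k =
      K * (F x y ^ 2 * (if i = k then 1 else 0) - F x y * pd (fun w => F x w) k y * y i)

/-- The density `σ` of the Busemann-Hausdorff volume form `σ(x) dx¹ ⋯ dxⁿ` of `F`: the volume of
the Euclidean unit ball divided by the volume of the unit ball of `F` at `x`. -/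
def bhDensity (F : Coord n → Coord n → ℝ) (x : Coord n) : ℝ :=
  (MeasureTheory.volume (Metric.ball (0 : Coord n) 1)).toReal /
    (MeasureTheory.volume {y : Coord n | F x y < 1}).toReal

/-- The S-curvature `S = ∂G^i/∂y^i - (y^i / σ) ∂σ/∂x^i`. -/
def sCurv (F : Coord n → Coord n → ℝ) (x y : Coord n) : ℝ :=
  ∑ i, pd (fun w => spray F x w i) i y - ∑ i, y i / bhDensity F x * pd (bhDensity F) i x

/-- `c` is a (non-constant) geodesic of `F` in `V`, defined on the open interval `(s, t)`. -/
structure IsGeodesicIn (F : Coord n → Coord n → ℝ) (V : Set (Coord n)) (s t : ℝ)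
    (c : ℝ → Coord n) : Prop where
  smooth : ContDiffOn ℝ 2 c (Set.Ioo s t)
  mem : ∀ τ ∈ Set.Ioo s t, c τ ∈ V
  regular : ∀ τ ∈ Set.Ioo s t, deriv c τ ≠ 0
  eqn : ∀ τ ∈ Set.Ioo s t, ∀ i, deriv (deriv c) τ i + 2 * spray F (c τ) (deriv c τ) i = 0

/-- `F` is locally projectively flat on `U`: around every point of `U` there is a smooth
coordinate system in which all geodesics are (parts of) straight lines, as point sets. -/
def IsLocallyProjectivelyFlatOn (U : Set (Coord n)) (F : Coord n → Coord n → ℝ) : Prop :=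
  ∀ p ∈ U, ∃ φ : OpenPartialHomeomorph (Coord n) (Coord n),
    p ∈ φ.source ∧ φ.source ⊆ U ∧ ContDiffOn ℝ ∞ φ φ.source ∧ ContDiffOn ℝ ∞ φ.symm φ.target ∧
      ∀ (s t : ℝ) (c : ℝ → Coord n), IsGeodesicIn F φ.source s t c →
        Collinear ℝ ((fun τ => φ (c τ)) '' Set.Ioo s t)

/-- `α` is the norm of the smooth Riemannian metric on `U` with coefficients `a`. -/
structure IsRiemannianNormOn (U : Set (Coord n)) (a : Coord n → Matrix (Fin n) (Fin n) ℝ)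
    (α : Coord n → Coord n → ℝ) : Prop where
  smooth : ∀ i j, ContDiffOn ℝ ∞ (fun x => a x i j) U
  posDef : ∀ x ∈ U, (a x).PosDef
  eq_sqrt : ∀ x ∈ U, ∀ y, α x y = Real.sqrt (∑ i, ∑ j, a x i j * y i * y j)

/-- `F` is the Randers metric `α + β` on `U`, where `α` is the norm of the Riemannian metric with
coefficients `a`, and `β` is the smooth 1-form with coefficients `b`, whose norm with respect to
`α`, the supremum of `β / α`, is less than one at each point. -/
structure IsRandersOn (U : Set (Coord n)) (a : Coord n → Matrix (Fin n) (Fin n) ℝ)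
    (b : Coord n → Fin n → ℝ) (α β F : Coord n → Coord n → ℝ) : Prop where
  riemannian : IsRiemannianNormOn U a α
  smooth : ∀ i, ContDiffOn ℝ ∞ (fun x => b x i) U
  oneForm : ∀ x ∈ U, ∀ y, β x y = ∑ i, b x i * y i
  norm_lt_one : ∀ x ∈ U, ∃ k : ℝ, k < 1 ∧ ∀ y, β x y ≤ k * α x y
  eq_sum : ∀ x ∈ U, ∀ y, F x y = α x y + β x y

/-- The Christoffel symbols `Γ^k_{ij}` of a Riemannian metric with coefficients `a`. -/
def christoffel (a : Coord n → Matrix (Fin n) (Fin n) ℝ) (k i j : Fin n) (x : Coord n) : ℝ :=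
  (1 / 2) * ∑ l, (a x)⁻¹ k l *
    (pd (fun x' => a x' j l) i x + pd (fun x' => a x' i l) j x - pd (fun x' => a x' i j) l x)

/-- The curvature tensor: `R(∂_i, ∂_j) ∂_k = ∑ l, (curvTensor a l k i j) ∂_l`. -/
def curvTensor (a : Coord n → Matrix (Fin n) (Fin n) ℝ) (l k i j : Fin n) (x : Coord n) : ℝ :=
  pd (christoffel a l j k) i x - pd (christoffel a l i k) j x
    + ∑ m, (christoffel a l i m x * christoffel a m j k x
      - christoffel a l j m x * christoffel a m i k x)

/-- The Gauss curvature `⟨R(∂_1, ∂_2) ∂_2, ∂_1⟩ / det a` of a surface metric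
(coordinates are numbered `0, 1` here). -/
def gaussCurv (a : Coord 2 → Matrix (Fin 2) (Fin 2) ℝ) (x : Coord 2) : ℝ :=
  (∑ l, a x 0 l * curvTensor a l 1 0 1 x) / (a x).det

/-- The Klein metric on the unit disk, as an inner product on the tangent space at `p`. Its norm is
`√(|w|² - (p₁w₂ - p₂w₁)²) / (1 - |p|²)`. -/
def klein (p w z : Coord 2) : ℝ :=
  ((w 0 * z 0 + w 1 * z 1) - (p 0 * w 1 - p 1 * w 0) * (p 0 * z 1 - p 1 * z 0)) /
    (1 - (p 0 ^ 2 + p 1 ^ 2)) ^ 2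

/-- The norm `Φ` of the Klein metric. -/
def kleinNorm (p w : Coord 2) : ℝ := Real.sqrt (klein p w w)

/-- The rotation field `(-y, x)` at the point `(x, y)`. -/
def rot (p : Coord 2) : Coord 2 := !₂[-(p 1), p 0]

/-- The Riemannian part `α`, as a function on tangent vectors. -/
def alpha (ε : ℝ) (p w : Coord 2) : ℝ :=
  Real.sqrt (ε ^ 2 * klein p (rot p) w ^ 2 + klein p w w * (1 - ε ^ 2 * klein p (rot p) (rot p))) /
    (1 - ε ^ 2 * klein p (rot p) (rot p))

/-- The 1-form `β`, as a function on tangent vectors. -/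
def beta (ε : ℝ) (p w : Coord 2) : ℝ :=
  -(ε * klein p (rot p) w / (1 - ε ^ 2 * klein p (rot p) (rot p)))

/-- The coefficients of the Riemannian metric whose norm is `α`. -/
def alphaCoeff (ε : ℝ) (p : Coord 2) : Matrix (Fin 2) (Fin 2) ℝ :=
  Matrix.of fun i j =>
    (ε ^ 2 * klein p (rot p) (e i) * klein p (rot p) (e j)
      + klein p (e i) (e j) * (1 - ε ^ 2 * klein p (rot p) (rot p))) /
    (1 - ε ^ 2 * klein p (rot p) (rot p)) ^ 2

/-- The coefficients of the 1-form `β`. -/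
def betaCoeff (ε : ℝ) (p : Coord 2) (i : Fin 2) : ℝ := beta ε p (e i)

/-- The metric `F = α + β`. -/
def randers (ε : ℝ) (p w : Coord 2) : ℝ := alpha ε p w + beta ε p w

/-- The open disk of radius `1 / √(1 + ε²)`. -/
def disk (ε : ℝ) : Set (Coord 2) := Metric.ball 0 (1 / Real.sqrt (1 + ε ^ 2))

end Finsler

end

/-!
The unit circle of `F` at `p` is the unit circle of the Klein metric at `p` translated by the
rotation field, up to the factor `ε`: `F` solves the navigation problem for the Klein metric and a
Killing field. Hence a geodesic of `F` is a Klein geodesic, i.e. a straight chord, turned about the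
origin at the constant speed `ε`. Differentiating the equation `Φ(y / F - ε v) = 1` gives the
derivatives of `F`; they show that `F` is horizontal for the spray read off from these curves,
which together with homogeneity identifies it as the spray of `F`. The flag curvature is the
Riemann curvature formula evaluated on this explicit spray. For the S-curvature, translating the
unit ball does not change its volume, so the Busemann-Hausdorff density is that of the Klein metric.

The geodesics through the origin are the spirals `tanh t • e^{iεt} u`. Two of them with opposite
initial velocities share their tangent at the origin but separate in the normal direction, by
`2 tanh t sin (εt)`, whereas in a projectively flat chart both would lie on one line. Finally, `α`
is rotationally symmetric, so its Christoffel symbols and Gauss curvature are explicit functions of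
`|p|²`.
-/

noncomputable section

namespace Finsler

open Filter Topology Function
open scoped RealInnerProductSpace

section DirectionalDerivative

variable {E : Type*} [NormedAddCommGroup E] [NormedSpace ℝ E]

/-- `f` is differentiable at `x`, with derivative `f'` in the direction `v`. Unlike Mathlib's
`HasLineDerivAt` this includes Fréchet differentiability, without which `pd` has no calculus. -/
structure HasDirDerivAt (f : E → ℝ) (f' : ℝ) (x v : E) : Prop where
  differentiableAt : DifferentiableAt ℝ f x
  fderiv_apply : fderiv ℝ f x v = f'

namespace HasDirDerivAt

variable {f g : E → ℝ} {f' g' : ℝ} {x v : E}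

theorem of_hasFDerivAt {L : E →L[ℝ] ℝ} (h : HasFDerivAt f L x) (v : E) :
    HasDirDerivAt f (L v) x v :=
  ⟨h.differentiableAt, by rw [h.fderiv]⟩

theorem congr_deriv (h : HasDirDerivAt f f' x v) (h' : f' = g') : HasDirDerivAt f g' x v := h' ▸ h

theorem congr_of_eventuallyEq (h : HasDirDerivAt f f' x v) (hfg : g =ᶠ[𝓝 x] f) :
    HasDirDerivAt g f' x v :=
  ⟨h.differentiableAt.congr_of_eventuallyEq hfg, by rw [hfg.fderiv_eq, h.fderiv_apply]⟩

theorem unique (h : HasDirDerivAt f f' x v) (h' : HasDirDerivAt f g' x v) : f' = g' :=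
  h.fderiv_apply.symm.trans h'.fderiv_apply

theorem const (c : ℝ) : HasDirDerivAt (fun _ => c) 0 x v :=
  of_hasFDerivAt (hasFDerivAt_const c x) v

theorem clm (L : E →L[ℝ] ℝ) : HasDirDerivAt (fun x => L x) (L v) x v :=
  of_hasFDerivAt L.hasFDerivAt v

theorem add (hf : HasDirDerivAt f f' x v) (hg : HasDirDerivAt g g' x v) :
    HasDirDerivAt (fun x => f x + g x) (f' + g') x v :=
  (of_hasFDerivAt (hf.1.hasFDerivAt.add hg.1.hasFDerivAt) v).congr_deriv (by
    rw [add_apply, hf.2, hg.2])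

theorem mul (hf : HasDirDerivAt f f' x v) (hg : HasDirDerivAt g g' x v) :
    HasDirDerivAt (fun x => f x * g x) (f' * g x + f x * g') x v :=
  (of_hasFDerivAt (hf.1.hasFDerivAt.mul hg.1.hasFDerivAt) v).congr_deriv (by
    rw [add_apply, smul_apply, smul_apply, hf.2, hg.2, smul_eq_mul, smul_eq_mul]
    ring)

theorem scomp {φ : ℝ → ℝ} {φ' : ℝ} (hφ : HasDerivAt φ φ' (f x)) (hf : HasDirDerivAt f f' x v) :
    HasDirDerivAt (fun x => φ (f x)) (φ' * f') x v :=
  (of_hasFDerivAt (hφ.comp_hasFDerivAt x hf.1.hasFDerivAt) v).congr_deriv (by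
    rw [smul_apply, hf.2, smul_eq_mul])

theorem const_mul (c : ℝ) (hf : HasDirDerivAt f f' x v) :
    HasDirDerivAt (fun x => c * f x) (c * f') x v :=
  ((const c).mul hf).congr_deriv (by ring)

theorem neg (hf : HasDirDerivAt f f' x v) : HasDirDerivAt (fun x => -f x) (-f') x v :=
  ⟨hf.1.neg, by rw [fderiv_fun_neg, neg_apply, hf.2]⟩

theorem sub (hf : HasDirDerivAt f f' x v) (hg : HasDirDerivAt g g' x v) :
    HasDirDerivAt (fun x => f x - g x) (f' - g') x v := by
  simpa only [sub_eq_add_neg] using hf.add hg.neg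

theorem pow_two (hf : HasDirDerivAt f f' x v) :
    HasDirDerivAt (fun x => f x ^ 2) (2 * f x * f') x v :=
  (hf.scomp (hasDerivAt_pow 2 (f x))).congr_deriv (by norm_num)

theorem div (hf : HasDirDerivAt f f' x v) (hg : HasDirDerivAt g g' x v) (h : g x ≠ 0) :
    HasDirDerivAt (fun x => f x / g x) ((f' * g x - f x * g') / g x ^ 2) x v := by
  simp only [div_eq_mul_inv]
  exact (hf.mul (hg.scomp (hasDerivAt_inv h))).congr_deriv (by field_simp; ring)

theorem sum {ι : Type*} {s : Finset ι} {f : ι → E → ℝ} {f' : ι → ℝ}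
    (h : ∀ j ∈ s, HasDirDerivAt (f j) (f' j) x v) :
    HasDirDerivAt (fun x => ∑ j ∈ s, f j x) (∑ j ∈ s, f' j) x v :=
  ⟨.fun_sum fun j hj => (h j hj).1, by
    rw [fderiv_fun_sum fun j hj => (h j hj).1, sum_apply]
    exact Finset.sum_congr rfl fun j hj => (h j hj).2⟩

end HasDirDerivAt

theorem fderiv_fderiv_apply_comm {f : E → ℝ} {x : E} (hf : ContDiffAt ℝ 2 f x) (v w : E) :
    fderiv ℝ (fun z => fderiv ℝ f z v) x w = fderiv ℝ (fun z => fderiv ℝ f z w) x v := by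
  have hd : DifferentiableAt ℝ (fderiv ℝ f) x :=
    (hf.fderiv_right (m := 1) (by norm_num)).differentiableAt one_ne_zero
  have hs : IsSymmSndFDerivAt ℝ f x := hf.isSymmSndFDerivAt (by simp)
  rw [fderiv_clm_apply hd (by fun_prop), fderiv_clm_apply hd (by fun_prop)]
  simpa using hs w v

end DirectionalDerivative

variable {n : ℕ}

theorem sum_smul_e (y : Coord n) : ∑ k, y k • e k = y := by
  ext i
  simp [e, Pi.single_apply]

section PartialDerivatives

/-- The partial derivative `F_{x^k}` in the position variable. -/
def dX (F : Coord n → Coord n → ℝ) (k : Fin n) (x y : Coord n) : ℝ := pd (fun x' => F x' y) k x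

/-- The partial derivative `F_{y^k}` in the vector variable. -/
def dY (F : Coord n → Coord n → ℝ) (k : Fin n) (x y : Coord n) : ℝ := pd (fun y' => F x y') k y

/-- Smoothness of a function on the tangent bundle, jointly in position and vector. -/
abbrev SmoothOn (F : Coord n → Coord n → ℝ) (Ω : Set (Coord n × Coord n)) : Prop :=
  ContDiffOn ℝ ∞ (uncurry F) Ω

variable {F G : Coord n → Coord n → ℝ} {Ω : Set (Coord n × Coord n)} {x y : Coord n} {f' : ℝ}

theorem HasDirDerivAt.left {a : Coord n} (h : HasDirDerivAt (uncurry F) f' (x, y) (a, 0)) :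
    HasDirDerivAt (fun x' => F x' y) f' x a :=
  (of_hasFDerivAt (h.1.hasFDerivAt.comp (f := fun x' => (x', y)) x
    (hasFDerivAt_prodMk_left x y)) a).congr_deriv (by simpa using h.2)

theorem HasDirDerivAt.right {b : Coord n} (h : HasDirDerivAt (uncurry F) f' (x, y) (0, b)) :
    HasDirDerivAt (fun y' => F x y') f' y b :=
  (of_hasFDerivAt (h.1.hasFDerivAt.comp (f := fun y' => (x, y')) y
    (hasFDerivAt_prodMk_right x y)) b).congr_deriv (by simpa using h.2)

namespace SmoothOn

theorem contDiffAt (hF : SmoothOn F Ω) (hΩ : IsOpen Ω) {z : Coord n × Coord n} (h : z ∈ Ω) :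
    ContDiffAt ℝ ∞ (uncurry F) z :=
  ContDiffOn.contDiffAt hF (hΩ.mem_nhds h)

theorem hasDirDerivAt_fderiv (hF : SmoothOn F Ω) (hΩ : IsOpen Ω) (h : (x, y) ∈ Ω)
    (v : Coord n × Coord n) :
    HasDirDerivAt (uncurry F) (fderiv ℝ (uncurry F) (x, y) v) (x, y) v :=
  ⟨(hF.contDiffAt hΩ h).differentiableAt (by simp), rfl⟩

theorem dX_eq (hF : SmoothOn F Ω) (hΩ : IsOpen Ω) (h : (x, y) ∈ Ω) (k : Fin n) :
    dX F k x y = fderiv ℝ (uncurry F) (x, y) (e k, 0) :=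
  (hF.hasDirDerivAt_fderiv hΩ h _).left.fderiv_apply

theorem dY_eq (hF : SmoothOn F Ω) (hΩ : IsOpen Ω) (h : (x, y) ∈ Ω) (k : Fin n) :
    dY F k x y = fderiv ℝ (uncurry F) (x, y) (0, e k) :=
  (hF.hasDirDerivAt_fderiv hΩ h _).right.fderiv_apply

theorem fderiv_apply_eq_sum (hF : SmoothOn F Ω) (hΩ : IsOpen Ω) (h : (x, y) ∈ Ω)
    (a b : Coord n) :
    fderiv ℝ (uncurry F) (x, y) (a, b) = ∑ k, a k * dX F k x y + ∑ k, b k * dY F k x y := by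
  have hab : ((a, b) : Coord n × Coord n) =
      ∑ k, a k • (e k, (0 : Coord n)) + ∑ k, b k • ((0 : Coord n), e k) := by
    ext1 <;> simp [Prod.fst_sum, Prod.snd_sum, sum_smul_e]
  simp only [hab, map_add, map_sum, map_smul, smul_eq_mul, hF.dX_eq hΩ h, hF.dY_eq hΩ h]

theorem hasDirDerivAt_left (hF : SmoothOn F Ω) (hΩ : IsOpen Ω) (h : (x, y) ∈ Ω) (k : Fin n) :
    HasDirDerivAt (fun x' => F x' y) (dX F k x y) x (e k) :=
  (hF.hasDirDerivAt_fderiv hΩ h _).left.congr_deriv (hF.dX_eq hΩ h k).symm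

theorem hasDirDerivAt_right (hF : SmoothOn F Ω) (hΩ : IsOpen Ω) (h : (x, y) ∈ Ω) (k : Fin n) :
    HasDirDerivAt (fun y' => F x y') (dY F k x y) y (e k) :=
  (hF.hasDirDerivAt_fderiv hΩ h _).right.congr_deriv (hF.dY_eq hΩ h k).symm

theorem fderiv_apply (hF : SmoothOn F Ω) (hΩ : IsOpen Ω) (v : Coord n × Coord n) :
    ContDiffOn ℝ ∞ (fun z => fderiv ℝ (uncurry F) z v) Ω :=
  (hF.fderiv_of_isOpen hΩ (by simp)).clm_apply contDiffOn_const

theorem dX_smooth (hF : SmoothOn F Ω) (hΩ : IsOpen Ω) (k : Fin n) : SmoothOn (dX F k) Ω :=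
  (hF.fderiv_apply hΩ (e k, 0)).congr fun _ hz => hF.dX_eq hΩ hz k

theorem dY_smooth (hF : SmoothOn F Ω) (hΩ : IsOpen Ω) (k : Fin n) : SmoothOn (dY F k) Ω :=
  (hF.fderiv_apply hΩ (0, e k)).congr fun _ hz => hF.dY_eq hΩ hz k

theorem fderiv_fderiv_comm (hF : SmoothOn F Ω) (hΩ : IsOpen Ω) (h : (x, y) ∈ Ω)
    (v w : Coord n × Coord n) :
    fderiv ℝ (fun z => fderiv ℝ (uncurry F) z v) (x, y) w =
      fderiv ℝ (fun z => fderiv ℝ (uncurry F) z w) (x, y) v :=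
  fderiv_fderiv_apply_comm ((hF.contDiffAt hΩ h).of_le (WithTop.coe_le_coe.2 le_top)) v w

theorem fderiv_dX (hF : SmoothOn F Ω) (hΩ : IsOpen Ω) (h : (x, y) ∈ Ω) (k : Fin n) :
    fderiv ℝ (uncurry (dX F k)) (x, y) =
      fderiv ℝ (fun z => fderiv ℝ (uncurry F) z (e k, 0)) (x, y) :=
  (eventuallyEq_of_mem (hΩ.mem_nhds h) fun _ hz => hF.dX_eq hΩ hz k).fderiv_eq

theorem fderiv_dY (hF : SmoothOn F Ω) (hΩ : IsOpen Ω) (h : (x, y) ∈ Ω) (k : Fin n) :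
    fderiv ℝ (uncurry (dY F k)) (x, y) =
      fderiv ℝ (fun z => fderiv ℝ (uncurry F) z (0, e k)) (x, y) :=
  (eventuallyEq_of_mem (hΩ.mem_nhds h) fun _ hz => hF.dY_eq hΩ hz k).fderiv_eq

theorem dX_dY_comm (hF : SmoothOn F Ω) (hΩ : IsOpen Ω) (h : (x, y) ∈ Ω) (j k : Fin n) :
    dX (dY F j) k x y = dY (dX F k) j x y := by
  rw [(hF.dY_smooth hΩ j).dX_eq hΩ h, (hF.dX_smooth hΩ k).dY_eq hΩ h,
    hF.fderiv_dY hΩ h, hF.fderiv_dX hΩ h, hF.fderiv_fderiv_comm hΩ h]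

theorem dY_dY_comm (hF : SmoothOn F Ω) (hΩ : IsOpen Ω) (h : (x, y) ∈ Ω) (j k : Fin n) :
    dY (dY F j) k x y = dY (dY F k) j x y := by
  rw [(hF.dY_smooth hΩ j).dY_eq hΩ h, (hF.dY_smooth hΩ k).dY_eq hΩ h,
    hF.fderiv_dY hΩ h, hF.fderiv_dY hΩ h, hF.fderiv_fderiv_comm hΩ h]

end SmoothOn

theorem eventually_left_mem (hΩ : IsOpen Ω) (h : (x, y) ∈ Ω) : ∀ᶠ x' in 𝓝 x, (x', y) ∈ Ω :=
  (Continuous.prodMk_left y).continuousAt.eventually (hΩ.mem_nhds h)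

theorem eventually_right_mem (hΩ : IsOpen Ω) (h : (x, y) ∈ Ω) : ∀ᶠ y' in 𝓝 y, (x, y') ∈ Ω :=
  (Continuous.prodMk_right x).continuousAt.eventually (hΩ.mem_nhds h)

theorem dX_congr (hΩ : IsOpen Ω) (hFG : ∀ x y, (x, y) ∈ Ω → F x y = G x y) (h : (x, y) ∈ Ω)
    (k : Fin n) : dX F k x y = dX G k x y := by
  simp only [dX, pd]
  rw [EventuallyEq.fderiv_eq ((eventually_left_mem hΩ h).mono fun x' hx' => hFG x' y hx')]

theorem dY_congr (hΩ : IsOpen Ω) (hFG : ∀ x y, (x, y) ∈ Ω → F x y = G x y) (h : (x, y) ∈ Ω)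
    (k : Fin n) : dY F k x y = dY G k x y := by
  simp only [dY, pd]
  rw [EventuallyEq.fderiv_eq ((eventually_right_mem hΩ h).mono fun y' hy' => hFG x y' hy')]

end PartialDerivatives

/-- The slit tangent bundle over `U`. -/
abbrev slit (U : Set (Coord n)) : Set (Coord n × Coord n) := U ×ˢ {y | y ≠ 0}

theorem isOpen_slit {U : Set (Coord n)} (hU : IsOpen U) : IsOpen (slit U) :=
  hU.prod isOpen_ne

theorem hasDirDerivAt_coord (i : Fin n) (x v : Coord n) :
    HasDirDerivAt (fun x : Coord n => x i) (v i) x v :=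
  HasDirDerivAt.clm (EuclideanSpace.proj i)

theorem hasDirDerivAt_sum_coord_mul {f : Fin n → Coord n → ℝ} {f' : Fin n → ℝ} {y : Coord n}
    {k : Fin n} (h : ∀ j, HasDirDerivAt (f j) (f' j) y (e k)) :
    HasDirDerivAt (fun y' => ∑ j, y' j * f j y') (f k y + ∑ j, y j * f' j) y (e k) :=
  (HasDirDerivAt.sum fun j _ => (hasDirDerivAt_coord j y (e k)).mul (h j)).congr_deriv (by
    simp [Finset.sum_add_distrib, e])

section FinslerMetric

variable {U : Set (Coord n)} {F : Coord n → Coord n → ℝ} {x y : Coord n}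

theorem SmoothOn.fundTensor_eq (hF : SmoothOn F (slit U)) (hU : IsOpen U)
    (h : (x, y) ∈ slit U) (i j : Fin n) :
    fundTensor F x y i j = dY F i x y * dY F j x y + F x y * dY (dY F i) j x y := by
  have hΩ := isOpen_slit hU
  have hF₁ : ∀ᶠ z in 𝓝 y, pd (fun w => F x w ^ 2) i z = 2 * F x z * dY F i x z :=
    (eventually_right_mem hΩ h).mono fun z hz =>
      (hF.hasDirDerivAt_right hΩ hz i).pow_two.fderiv_apply
  have hF₂ := ((((hF.hasDirDerivAt_right hΩ h j).const_mul 2).mul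
    ((hF.dY_smooth hΩ i).hasDirDerivAt_right hΩ h j)).congr_of_eventuallyEq hF₁).fderiv_apply
  rw [fundTensor, Matrix.of_apply, pd, hF₂]
  ring

theorem SmoothOn.sum_fundTensor_mul (hF : SmoothOn F (slit U)) (hU : IsOpen U)
    (h : (x, y) ∈ slit U) (i : Fin n) (u : Fin n → ℝ) :
    ∑ j, fundTensor F x y i j * u j =
      dY F i x y * ∑ j, u j * dY F j x y + F x y * ∑ j, u j * dY (dY F i) j x y := by
  simp only [hF.fundTensor_eq hU h, Finset.mul_sum, ← Finset.sum_add_distrib]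
  exact Finset.sum_congr rfl fun j _ => by ring

theorem SmoothOn.smoothOn_fundTensor (hF : SmoothOn F (slit U)) (hU : IsOpen U) (i j : Fin n) :
    SmoothOn (fun x y => fundTensor F x y i j) (slit U) := by
  have hΩ := isOpen_slit hU
  exact ((ContDiffOn.mul (hF.dY_smooth hΩ i) (hF.dY_smooth hΩ j)).add
    (ContDiffOn.mul hF ((hF.dY_smooth hΩ i).dY_smooth hΩ j))).congr
      fun _ hz => hF.fundTensor_eq hU hz i j

theorem SmoothOn.fundTensor_comm (hF : SmoothOn F (slit U)) (hU : IsOpen U)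
    (h : (x, y) ∈ slit U) (i j : Fin n) :
    fundTensor F x y i j = fundTensor F x y j i := by
  rw [hF.fundTensor_eq hU h, hF.fundTensor_eq hU h, hF.dY_dY_comm (isOpen_slit hU) h]
  ring

namespace IsFinslerOn

theorem smoothOn (hF : IsFinslerOn U F) : SmoothOn F (slit U) := hF.smooth

theorem euler (hF : IsFinslerOn U F) (hU : IsOpen U) (h : (x, y) ∈ slit U) :
    ∑ k, y k * dY F k x y = F x y := by
  have hd := hF.smoothOn.hasDirDerivAt_fderiv (isOpen_slit hU) h (0, y)
  have hy : HasDerivAt (fun t : ℝ => t • y) y 1 := by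
    simpa using (hasDerivAt_id (1 : ℝ)).smul_const y
  have hFy : HasDerivAt (fun t : ℝ => F x (t • y)) (fderiv ℝ (F x) y y) 1 :=
    HasFDerivAt.comp_hasDerivAt (1 : ℝ) (by simpa using hd.right.1.hasFDerivAt) hy
  have hF_lin : HasDerivAt (fun t : ℝ => F x (t • y)) (F x y) 1 := by
    refine HasDerivAt.congr_of_eventuallyEq (f := fun t : ℝ => t * F x y) ?_ ?_
    · simpa using (hasDerivAt_id (1 : ℝ)).mul_const (F x y)
    · filter_upwards [lt_mem_nhds (zero_lt_one' ℝ)] with t ht using hF.homog x h.1 y t ht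
  calc ∑ k, y k * dY F k x y = fderiv ℝ (uncurry F) (x, y) (0, y) := by
        simp [hF.smoothOn.fderiv_apply_eq_sum (isOpen_slit hU) h]
    _ = F x y := by rw [← hd.right.fderiv_apply]; exact hFy.unique hF_lin

theorem euler_dY (hF : IsFinslerOn U F) (hU : IsOpen U) (h : (x, y) ∈ slit U) (k : Fin n) :
    ∑ j, y j * dY (dY F k) j x y = 0 := by
  have hΩ := isOpen_slit hU
  have hs := hF.smoothOn
  have hsum := hasDirDerivAt_sum_coord_mul fun j => (hs.dY_smooth hΩ j).hasDirDerivAt_right hΩ h k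
  have hF_eq := hsum.unique <| (hs.hasDirDerivAt_right hΩ h k).congr_of_eventuallyEq <|
    (eventually_right_mem hΩ h).mono fun _ hy' => hF.euler hU hy'
  simpa only [hs.dY_dY_comm hΩ h _ k, add_eq_left] using hF_eq

theorem sum_fundTensor_mul_vec (hF : IsFinslerOn U F) (hU : IsOpen U) (h : (x, y) ∈ slit U)
    (k : Fin n) : ∑ p, fundTensor F x y p k * y p = F x y * dY F k x y := by
  simp only [hF.smoothOn.fundTensor_comm hU h _ k]
  rw [hF.smoothOn.sum_fundTensor_mul hU h, hF.euler hU h, hF.euler_dY hU h]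
  ring

theorem sum_sum_fundTensor_mul_vec (hF : IsFinslerOn U F) (hU : IsOpen U) (h : (x, y) ∈ slit U) :
    ∑ p, ∑ q, fundTensor F x y p q * y p * y q = F x y ^ 2 := by
  rw [Finset.sum_comm]
  simp only [← Finset.sum_mul, hF.sum_fundTensor_mul_vec hU h]
  simp only [mul_assoc, mul_comm (dY F _ x y), ← Finset.mul_sum, hF.euler hU h, sq]

theorem sum_dX_fundTensor_mul_vec (hF : IsFinslerOn U F) (hU : IsOpen U)
    (h : (x, y) ∈ slit U) (q k : Fin n) :
    ∑ p, dX (fun x y => fundTensor F x y p k) q x y * y p =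
      dX F q x y * dY F k x y + F x y * dX (dY F k) q x y := by
  have hΩ := isOpen_slit hU
  have hs := hF.smoothOn
  have hsum : HasDirDerivAt (fun x' => ∑ p, fundTensor F x' y p k * y p)
      (∑ p, (dX (fun x y => fundTensor F x y p k) q x y * y p + fundTensor F x y p k * 0))
      x (e q) :=
    .sum fun p _ => ((hs.smoothOn_fundTensor hU p k).hasDirDerivAt_left hΩ h q).mul (.const _)
  have hprod := ((hs.hasDirDerivAt_left hΩ h q).mul
    ((hs.dY_smooth hΩ k).hasDirDerivAt_left hΩ h q)).congr_of_eventuallyEq <|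
      (eventually_left_mem hΩ h).mono fun x' hx' => hF.sum_fundTensor_mul_vec hU hx' k
  simpa only [mul_zero, add_zero] using hsum.unique hprod

theorem sum_sum_dX_fundTensor_mul_vec (hF : IsFinslerOn U F) (hU : IsOpen U)
    (h : (x, y) ∈ slit U) (k : Fin n) :
    ∑ p, ∑ q, dX (fun x y => fundTensor F x y p q) k x y * y p * y q =
      2 * F x y * dX F k x y := by
  have hΩ := isOpen_slit hU
  have hs := hF.smoothOn
  have hsum : HasDirDerivAt (fun x' => ∑ p, ∑ q, fundTensor F x' y p q * y p * y q)
      (∑ p, ∑ q, ((dX (fun x y => fundTensor F x y p q) k x y * y p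
        + fundTensor F x y p q * 0) * y q + fundTensor F x y p q * y p * 0)) x (e k) :=
    .sum fun p _ => .sum fun q _ =>
      (((hs.smoothOn_fundTensor hU p q).hasDirDerivAt_left hΩ h k).mul (.const _)).mul (.const _)
  have hsq := (hs.hasDirDerivAt_left hΩ h k).pow_two.congr_of_eventuallyEq <|
    (eventually_left_mem hΩ h).mono fun x' hx' => hF.sum_sum_fundTensor_mul_vec hU hx'
  simpa only [mul_zero, add_zero] using hsum.unique hsq

theorem isUnit_det_fundTensor (hF : IsFinslerOn U F) (h : (x, y) ∈ slit U) :
    IsUnit (fundTensor F x y).det := by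
  refine isUnit_iff_ne_zero.2 fun hdet => ?_
  obtain ⟨v, hv, hker⟩ := Matrix.exists_mulVec_eq_zero_iff.2 hdet
  have hpos := hF.convex x h.1 y h.2 (WithLp.toLp 2 v) (by simpa using hv)
  have hzero : ∑ i, v i * (fundTensor F x y).mulVec v i = 0 := by simp [hker]
  simp only [Matrix.mulVec, dotProduct, Finset.mul_sum] at hzero
  exact hpos.ne' (hzero ▸ Finset.sum_congr rfl fun i _ => Finset.sum_congr rfl fun j _ => by ring)

end IsFinslerOn

end FinslerMetric

section Spray

variable {U : Set (Coord n)} {F : Coord n → Coord n → ℝ} {G : Fin n → Coord n → Coord n → ℝ}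
  {x y : Coord n}

/-- The first-order system that characterises the spray coefficients `G` of a Finsler metric `F`:
`G` is homogeneous of degree two, and `F` is horizontal for the connection `∂G^j/∂y^k`. It spares
inverting the fundamental tensor. -/
structure IsSprayOn (U : Set (Coord n)) (F : Coord n → Coord n → ℝ)
    (G : Fin n → Coord n → Coord n → ℝ) : Prop where
  smooth : ∀ i, SmoothOn (G i) (slit U)
  euler : ∀ x ∈ U, ∀ y, y ≠ 0 → ∀ i, ∑ k, y k * dY (G i) k x y = 2 * G i x y
  horizontal : ∀ x ∈ U, ∀ y, y ≠ 0 → ∀ k, dX F k x y = ∑ j, dY (G j) k x y * dY F j x y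

/-- The geodesic vector field `y^k ∂/∂x^k - 2 G^k ∂/∂y^k` of `G` on the tangent bundle. -/
def geodesicField (G : Fin n → Coord n → Coord n → ℝ) (x y : Coord n) : Coord n × Coord n :=
  (y, WithLp.toLp 2 fun k => -2 * G k x y)

/-- The derivative of `F` along the geodesic vector field of `G`. -/
def sprayDeriv (G : Fin n → Coord n → Coord n → ℝ) (F : Coord n → Coord n → ℝ)
    (x y : Coord n) : ℝ :=
  fderiv ℝ (uncurry F) (x, y) (geodesicField G x y)

theorem SmoothOn.sprayDeriv_eq (hF : SmoothOn F (slit U)) (hU : IsOpen U) (h : (x, y) ∈ slit U) :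
    sprayDeriv G F x y = ∑ k, y k * dX F k x y - 2 * ∑ k, G k x y * dY F k x y := by
  rw [sprayDeriv, geodesicField, hF.fderiv_apply_eq_sum (isOpen_slit hU) h]
  simp [Finset.mul_sum, mul_assoc, sub_eq_add_neg]

namespace IsSprayOn

theorem sum_mul_dX (hG : IsSprayOn U F G) (h : (x, y) ∈ slit U) :
    ∑ k, y k * dX F k x y = 2 * ∑ j, G j x y * dY F j x y := by
  simp only [hG.horizontal x h.1 y h.2, Finset.mul_sum]
  rw [Finset.sum_comm]
  refine Finset.sum_congr rfl fun j _ => ?_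
  rw [← mul_assoc, ← hG.euler x h.1 y h.2 j, Finset.sum_mul]
  exact Finset.sum_congr rfl fun k _ => by ring

theorem sum_mul_dX_dY (hG : IsSprayOn U F G) (hF : SmoothOn F (slit U)) (hU : IsOpen U)
    (h : (x, y) ∈ slit U) (k : Fin n) :
    ∑ j, y j * dX (dY F k) j x y = dX F k x y + 2 * ∑ j, G j x y * dY (dY F k) j x y := by
  have hΩ := isOpen_slit hU
  have hdX := hasDirDerivAt_sum_coord_mul fun j => (hF.dX_smooth hΩ j).hasDirDerivAt_right hΩ h k
  have hdY := (HasDirDerivAt.sum (s := Finset.univ) fun j _ =>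
    ((hG.smooth j).hasDirDerivAt_right hΩ h k).mul
      ((hF.dY_smooth hΩ j).hasDirDerivAt_right hΩ h k)).const_mul 2
  have hsum := hdX.unique <| hdY.congr_of_eventuallyEq <|
    (eventually_right_mem hΩ h).mono fun _ hy' => hG.sum_mul_dX hy'
  simp only [Finset.sum_add_distrib, mul_add, ← hG.horizontal x h.1 y h.2 k,
    ← hF.dX_dY_comm hΩ h k] at hsum
  simp only [hF.dY_dY_comm hΩ h k]
  linarith

theorem sprayDeriv_eq_zero (hG : IsSprayOn U F G) (hF : SmoothOn F (slit U)) (hU : IsOpen U)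
    (h : (x, y) ∈ slit U) : sprayDeriv G F x y = 0 := by
  rw [hF.sprayDeriv_eq hU h, hG.sum_mul_dX h, sub_self]

theorem sprayDeriv_dY (hG : IsSprayOn U F G) (hF : SmoothOn F (slit U)) (hU : IsOpen U)
    (h : (x, y) ∈ slit U) (k : Fin n) : sprayDeriv G (dY F k) x y = dX F k x y := by
  rw [(hF.dY_smooth (isOpen_slit hU) k).sprayDeriv_eq hU h, hG.sum_mul_dX_dY hF hU h,
    add_sub_cancel_right]

theorem sum_sum_dX_fundTensor_eq (hG : IsSprayOn U F G) (hF : IsFinslerOn U F) (hU : IsOpen U)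
    (h : (x, y) ∈ slit U) (k : Fin n) :
    ∑ p, ∑ q, (2 * dX (fun x y => fundTensor F x y p k) q x y
        - dX (fun x y => fundTensor F x y p q) k x y) * y p * y q =
      4 * ∑ j, fundTensor F x y k j * G j x y := by
  have hs := hF.smoothOn
  calc _ = 2 * ∑ q, (∑ p, dX (fun x y => fundTensor F x y p k) q x y * y p) * y q
          - ∑ p, ∑ q, dX (fun x y => fundTensor F x y p q) k x y * y p * y q := by
        simp only [Finset.sum_mul, Finset.mul_sum]
        rw [Finset.sum_comm (f := fun q p => 2 * (_ * _ * _))]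
        simp only [← Finset.sum_sub_distrib]
        exact Finset.sum_congr rfl fun p _ => Finset.sum_congr rfl fun q _ => by ring
    _ = 2 * (dY F k x y * ∑ q, y q * dX F q x y + F x y * ∑ q, y q * dX (dY F k) q x y)
          - 2 * F x y * dX F k x y := by
        simp only [hF.sum_dX_fundTensor_mul_vec hU h, hF.sum_sum_dX_fundTensor_mul_vec hU h,
          Finset.mul_sum, ← Finset.sum_add_distrib]
        exact congrArg (· - _) (Finset.sum_congr rfl fun q _ => by ring)
    _ = 4 * ∑ j, fundTensor F x y k j * G j x y := by
        rw [hG.sum_mul_dX h, hG.sum_mul_dX_dY hs hU h, hs.sum_fundTensor_mul hU h]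
        ring

theorem spray_eq (hG : IsSprayOn U F G) (hF : IsFinslerOn U F) (hU : IsOpen U)
    (h : (x, y) ∈ slit U) (i : Fin n) : spray F x y i = G i x y := by
  have hinv : (fundTensor F x y)⁻¹.mulVec ((fundTensor F x y).mulVec fun j => G j x y) i =
      G i x y := by
    rw [Matrix.mulVec_mulVec, Matrix.nonsing_inv_mul _ (hF.isUnit_det_fundTensor h),
      Matrix.one_mulVec]
  calc spray F x y i = 1 / 4 * ∑ k, (fundTensor F x y)⁻¹ i k *
        (4 * ∑ j, fundTensor F x y k j * G j x y) := by
        simp only [← hG.sum_sum_dX_fundTensor_eq hF hU h]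
        rfl
    _ = G i x y := by
        rw [← hinv]
        simp only [Matrix.mulVec, dotProduct, mul_left_comm _ (4 : ℝ), ← Finset.mul_sum]
        ring

theorem dY_spray_eq (hG : IsSprayOn U F G) (hF : IsFinslerOn U F) (hU : IsOpen U)
    (h : (x, y) ∈ slit U) (i k : Fin n) :
    dY (fun x y => spray F x y i) k x y = dY (G i) k x y :=
  dY_congr (isOpen_slit hU) (fun _ _ h' => hG.spray_eq hF hU h' i) h k

theorem riemCurv_eq (hG : IsSprayOn U F G) (hF : IsFinslerOn U F) (hU : IsOpen U)
    (h : (x, y) ∈ slit U) (i k : Fin n) :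
    riemCurv F x y i k = 2 * dX (G i) k x y - sprayDeriv G (dY (G i) k) x y
      - ∑ j, dY (G i) j x y * dY (G j) k x y := by
  have hΩ := isOpen_slit hU
  have hdY (i k : Fin n) (x y : Coord n) (h' : (x, y) ∈ slit U) := hG.dY_spray_eq hF hU h' i k
  rw [((hG.smooth i).dY_smooth hΩ k).sprayDeriv_eq hU h, sub_sub_eq_add_sub, add_sub_right_comm,
    ← dX_congr hΩ (fun _ _ h' => hG.spray_eq hF hU h' i) h k]
  simp only [← hG.spray_eq hF hU h, ← hdY _ _ x y h, ← dX_congr hΩ (hdY i k) h,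
    ← dY_congr hΩ (hdY i k) h]
  rfl

end IsSprayOn

end Spray

section Quadratic

variable {a b c s t : ℝ}

theorem add_pos_of_mul_sq_add_pos (ha : 0 < a) (ht : 0 < t) (h : 0 < a * t ^ 2 + 2 * b * t) :
    0 < a * t + b := by
  have hroot : 0 < a * t + 2 * b := pos_of_mul_pos_right (by linarith [h] : 0 < t * _) ht.le
  nlinarith [mul_pos ha ht]

theorem eq_of_quadratic_eq (ha : 0 < a) (hs : a * s ^ 2 + 2 * b * s = c) (hs' : 0 ≤ a * s + b)
    (hc : 0 < c) (ht : 0 < t) (h : a * t ^ 2 + 2 * b * t = c) : t = s := by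
  have ht' := add_pos_of_mul_sq_add_pos ha ht (h ▸ hc)
  have hfactor : (t - s) * ((a * t + b) + (a * s + b)) = 0 := by linear_combination h - hs
  exact sub_eq_zero.1 ((mul_eq_zero.1 hfactor).resolve_right (by positivity))

theorem lt_iff_lt_quadratic (ha : 0 < a) (hs : a * s ^ 2 + 2 * b * s = c) (hs' : 0 ≤ a * s + b)
    (hc : 0 ≤ c) (ht : 0 < t) : s < t ↔ c < a * t ^ 2 + 2 * b * t := by
  have hfactor : a * t ^ 2 + 2 * b * t - c = (t - s) * ((a * t + b) + (a * s + b)) := by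
    linear_combination hs
  rw [← sub_pos, ← sub_pos (b := c), hfactor]
  constructor <;> intro h
  · exact mul_pos h (by nlinarith)
  · have ht' := add_pos_of_mul_sq_add_pos ha ht (by linarith : 0 < a * t ^ 2 + 2 * b * t)
    exact pos_of_mul_pos_left h (by positivity)

end Quadratic

section Klein

variable {p y : Coord 2}

@[simp] theorem rot_apply_zero (p : Coord 2) : rot p 0 = -p 1 := rfl

@[simp] theorem rot_apply_one (p : Coord 2) : rot p 1 = p 0 := rfl

@[simp] theorem e_apply {n : ℕ} (i j : Fin n) : e i j = if j = i then (1 : ℝ) else 0 := by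
  simp [e]

theorem real_inner_eq (x y : Coord 2) : ⟪x, y⟫ = x 0 * y 0 + x 1 * y 1 := by
  simp [PiLp.inner_apply, mul_comm]

theorem norm_sq_eq (x : Coord 2) : ‖x‖ ^ 2 = x 0 ^ 2 + x 1 ^ 2 := by
  rw [EuclideanSpace.real_norm_sq_eq, Fin.sum_univ_two]

theorem rot_sub (x y : Coord 2) : rot (x - y) = rot x - rot y := by
  ext i
  fin_cases i
  · exact neg_sub' _ _
  · rfl

theorem rot_add (x y : Coord 2) : rot (x + y) = rot x + rot y := by
  ext i
  fin_cases i
  · exact neg_add _ _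
  · rfl

theorem rot_smul (t : ℝ) (x : Coord 2) : rot (t • x) = t • rot x := by
  ext i
  fin_cases i
  · exact (mul_neg _ _).symm
  · rfl

@[simp] theorem rot_zero : rot 0 = 0 := by
  simpa using rot_smul 0 0

theorem rot_rot (x : Coord 2) : rot (rot x) = -x := by
  ext i
  fin_cases i <;> rfl

theorem inner_rot_left (x y : Coord 2) : ⟪rot x, y⟫ = -⟪x, rot y⟫ := by
  simp only [real_inner_eq, rot_apply_zero, rot_apply_one]
  ring

theorem inner_rot_self (x : Coord 2) : ⟪x, rot x⟫ = 0 := by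
  simp only [real_inner_eq, rot_apply_zero, rot_apply_one]
  ring

theorem inner_rot_rot (x y : Coord 2) : ⟪rot x, rot y⟫ = ⟪x, y⟫ := by
  simp only [real_inner_eq, rot_apply_zero, rot_apply_one]
  ring

/-- The denominator `1 - |p|²` of the Klein metric. -/
def kleinDen (p : Coord 2) : ℝ := 1 - ‖p‖ ^ 2

/-- The Klein metric multiplied by `(1 - |p|²)²`, which is polynomial in `p`. -/
def kleinForm (p y z : Coord 2) : ℝ := kleinDen p * ⟪y, z⟫ + ⟪p, y⟫ * ⟪p, z⟫

theorem klein_eq (p y z : Coord 2) : klein p y z = kleinForm p y z / kleinDen p ^ 2 := by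
  simp only [klein, kleinForm, kleinDen, real_inner_eq, norm_sq_eq]
  congr 1
  ring

theorem kleinForm_comm (p y z : Coord 2) : kleinForm p y z = kleinForm p z y := by
  rw [kleinForm, kleinForm, real_inner_comm, mul_comm ⟪p, y⟫]

theorem kleinForm_nonneg (hp : 0 < kleinDen p) (y : Coord 2) : 0 ≤ kleinForm p y y := by
  rw [kleinForm, real_inner_self_eq_norm_sq]
  exact add_nonneg (by positivity) (mul_self_nonneg _)

theorem kleinForm_pos (hp : 0 < kleinDen p) (hy : y ≠ 0) : 0 < kleinForm p y y := by
  rw [kleinForm, real_inner_self_eq_norm_sq]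
  exact add_pos_of_pos_of_nonneg (by positivity) (mul_self_nonneg _)

theorem kleinForm_rot (p y : Coord 2) : kleinForm p (rot p) y = kleinDen p * ⟪rot p, y⟫ := by
  simp only [kleinForm, real_inner_eq, rot_apply_zero, rot_apply_one]
  ring

theorem kleinForm_sub_smul_rot_left (p y z : Coord 2) (s : ℝ) :
    kleinForm p (y - s • rot p) z = kleinForm p y z - s * (kleinDen p * ⟪rot p, z⟫) := by
  rw [← kleinForm_rot]
  simp only [kleinForm, inner_sub_left, inner_sub_right, real_inner_smul_left,
    real_inner_smul_right]
  ring

theorem kleinForm_sub_smul_rot_sub_smul_rot (p y z : Coord 2) (s t : ℝ) :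
    kleinForm p (y - s • rot p) (z - t • rot p) = kleinForm p y z
      - kleinDen p * (s * ⟪rot p, z⟫ + t * ⟪rot p, y⟫ - s * t * ‖p‖ ^ 2) := by
  rw [kleinForm_sub_smul_rot_left, kleinForm_comm, kleinForm_sub_smul_rot_left, inner_sub_right,
    real_inner_smul_right, inner_rot_rot, real_inner_self_eq_norm_sq, kleinForm_comm]
  ring

theorem kleinForm_sq_le (hp : 0 < kleinDen p) (y z : Coord 2) :
    kleinForm p y z ^ 2 ≤ kleinForm p y y * kleinForm p z z := by
  have hgram : kleinForm p y y * kleinForm p z z - kleinForm p y z ^ 2 =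
      kleinDen p * ⟪rot y, z⟫ ^ 2 := by
    simp only [kleinForm, kleinDen, real_inner_eq, norm_sq_eq, rot_apply_zero, rot_apply_one]
    ring
  have : 0 ≤ kleinDen p * ⟪rot y, z⟫ ^ 2 := by positivity
  linarith

theorem kleinNorm_eq_one_iff (hp : 0 < kleinDen p) :
    kleinNorm p y = 1 ↔ kleinForm p y y = kleinDen p ^ 2 := by
  rw [kleinNorm, Real.sqrt_eq_one, klein_eq, div_eq_one_iff_eq (by positivity)]

end Klein

section Randers

variable {ε : ℝ} {p y : Coord 2}

/-- `1 - (1 + ε²) |p|²`, which is positive exactly on `disk ε`. -/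
def randersDen (ε : ℝ) (p : Coord 2) : ℝ := 1 - (1 + ε ^ 2) * ‖p‖ ^ 2

/-- The quantity under the square root in `α`, rescaled. -/
def randersDisc (ε : ℝ) (p y : Coord 2) : ℝ :=
  ε ^ 2 * ⟪rot p, y⟫ ^ 2 + randersDen ε p * kleinForm p y y / kleinDen p

theorem mem_disk_iff : p ∈ disk ε ↔ 0 < randersDen ε p := by
  have hc : 0 < 1 + ε ^ 2 := by positivity
  rw [disk, mem_ball_zero_iff, ← sq_lt_sq₀ (norm_nonneg _) (by positivity), div_pow,
    Real.sq_sqrt hc.le, one_pow, lt_div_iff₀ hc, randersDen, sub_pos, mul_comm]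

theorem isOpen_disk (ε : ℝ) : IsOpen (disk ε) := Metric.isOpen_ball

theorem zero_mem_disk (ε : ℝ) : (0 : Coord 2) ∈ disk ε := by
  simp [mem_disk_iff, randersDen]

theorem randersDen_pos (hp : p ∈ disk ε) : 0 < randersDen ε p := mem_disk_iff.1 hp

theorem kleinDen_eq (ε : ℝ) (p : Coord 2) : kleinDen p = randersDen ε p + ε ^ 2 * ‖p‖ ^ 2 := by
  rw [kleinDen, randersDen]
  ring

theorem kleinDen_pos (hp : p ∈ disk ε) : 0 < kleinDen p := by
  have := randersDen_pos hp
  rw [kleinDen_eq ε]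
  positivity

theorem klein_rot (hp : p ∈ disk ε) (y : Coord 2) :
    klein p (rot p) y = ⟪rot p, y⟫ / kleinDen p := by
  have := kleinDen_pos hp
  rw [klein_eq, kleinForm_rot]
  field_simp

theorem one_sub_klein_rot (hp : p ∈ disk ε) :
    1 - ε ^ 2 * klein p (rot p) (rot p) = randersDen ε p / kleinDen p := by
  have := kleinDen_pos hp
  rw [klein_rot hp, inner_rot_rot, real_inner_self_eq_norm_sq]
  field_simp
  rw [kleinDen_eq ε]
  ring

theorem randersDisc_pos (hp : p ∈ disk ε) (hy : y ≠ 0) : 0 < randersDisc ε p y := by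
  have := randersDen_pos hp
  have := kleinDen_pos hp
  have := kleinForm_pos this hy
  unfold randersDisc
  positivity

theorem randersDisc_nonneg (hp : p ∈ disk ε) (y : Coord 2) : 0 ≤ randersDisc ε p y := by
  have := randersDen_pos hp
  have := kleinDen_pos hp
  have := kleinForm_nonneg this y
  unfold randersDisc
  positivity

theorem alpha_eq (hp : p ∈ disk ε) (y : Coord 2) :
    alpha ε p y = √(randersDisc ε p y) / randersDen ε p := by
  have hq := kleinDen_pos hp
  have hD := randersDen_pos hp
  have hdisc : ε ^ 2 * (⟪rot p, y⟫ / kleinDen p) ^ 2 +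
      kleinForm p y y / kleinDen p ^ 2 * (randersDen ε p / kleinDen p) =
        randersDisc ε p y / kleinDen p ^ 2 := by
    rw [randersDisc]
    field_simp
  rw [alpha, one_sub_klein_rot hp, klein_rot hp, klein_eq, hdisc,
    Real.sqrt_div (randersDisc_nonneg hp y), Real.sqrt_sq hq.le]
  field_simp

theorem beta_eq (hp : p ∈ disk ε) (y : Coord 2) :
    beta ε p y = -(ε * ⟪rot p, y⟫ / randersDen ε p) := by
  have hq := kleinDen_pos hp
  have hD := randersDen_pos hp
  rw [beta, one_sub_klein_rot hp, klein_rot hp]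
  field_simp

theorem randers_eq (hp : p ∈ disk ε) (y : Coord 2) :
    randers ε p y = (√(randersDisc ε p y) - ε * ⟪rot p, y⟫) / randersDen ε p := by
  rw [randers, alpha_eq hp, beta_eq hp]
  ring

/-- The square root `D F + ε c` of the discriminant of the quadratic equation
`D F² + 2 ε c F = K / q` for `F`, where `D = randersDen ε p`, `c = ⟪rot p, y⟫`,
`K = kleinForm p y y` and `q = kleinDen p`. -/
def randersRoot (ε : ℝ) (p y : Coord 2) : ℝ := randersDen ε p * randers ε p y + ε * ⟪rot p, y⟫

theorem randersRoot_eq_sqrt (hp : p ∈ disk ε) (y : Coord 2) :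
    randersRoot ε p y = √(randersDisc ε p y) := by
  have := randersDen_pos hp
  rw [randersRoot, randers_eq hp]
  field_simp
  ring

theorem randersRoot_pos (hp : p ∈ disk ε) (hy : y ≠ 0) : 0 < randersRoot ε p y := by
  rw [randersRoot_eq_sqrt hp]
  exact Real.sqrt_pos.2 (randersDisc_pos hp hy)

theorem randers_quadratic (hp : p ∈ disk ε) (y : Coord 2) :
    randersDen ε p * randers ε p y ^ 2 + 2 * (ε * ⟪rot p, y⟫) * randers ε p y =
      kleinForm p y y / kleinDen p := by
  have hD := randersDen_pos hp
  have hsq := Real.sq_sqrt (randersDisc_nonneg hp y)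
  rw [← randersRoot_eq_sqrt hp, randersRoot, randersDisc] at hsq
  refine mul_left_cancel₀ hD.ne' ?_
  linear_combination hsq

theorem randers_pos (hp : p ∈ disk ε) (hy : y ≠ 0) : 0 < randers ε p y := by
  have hq := kleinDen_pos hp
  have hD := randersDen_pos hp
  have hK := kleinForm_pos hq hy
  rw [randers_eq hp]
  refine div_pos (sub_pos.2 (Real.lt_sqrt_of_sq_lt ?_)) hD
  have : 0 < randersDen ε p * kleinForm p y y / kleinDen p := by positivity
  rw [randersDisc]
  linarith

/-- The unit ball of `F` at `p` is that of the Klein metric, translated by `ε • rot p`. -/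
theorem kleinForm_sub_smul_rot (ε : ℝ) (p y : Coord 2) (t : ℝ) :
    kleinForm p (y - (ε * t) • rot p) (y - (ε * t) • rot p) =
      kleinForm p y y - kleinDen p * (randersDen ε p * t ^ 2 + 2 * (ε * ⟪rot p, y⟫) * t)
        + (kleinDen p * t) ^ 2 := by
  rw [kleinForm_sub_smul_rot_sub_smul_rot]
  linear_combination -kleinDen p * t ^ 2 * kleinDen_eq ε p

theorem kleinForm_smul_self (p y : Coord 2) (t : ℝ) :
    kleinForm p (t • y) (t • y) = t ^ 2 * kleinForm p y y := by
  simp only [kleinForm, inner_smul_left, inner_smul_right, RCLike.conj_to_real]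
  ring

theorem kleinNorm_eq_one_iff_eq_randers (hp : p ∈ disk ε) (hy : y ≠ 0) {t : ℝ} (ht : 0 < t) :
    kleinNorm p (t⁻¹ • y - ε • rot p) = 1 ↔ t = randers ε p y := by
  have hq := kleinDen_pos hp
  have hK := kleinForm_pos hq hy
  have hscale : t⁻¹ • y - ε • rot p = t⁻¹ • (y - (ε * t) • rot p) := by
    rw [smul_sub, smul_smul, mul_comm ε, inv_mul_cancel_left₀ ht.ne']
  have hquad : kleinNorm p (t⁻¹ • y - ε • rot p) = 1 ↔
      randersDen ε p * t ^ 2 + 2 * (ε * ⟪rot p, y⟫) * t = kleinForm p y y / kleinDen p := by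
    rw [kleinNorm_eq_one_iff hq, hscale, kleinForm_smul_self, kleinForm_sub_smul_rot,
      inv_pow, inv_mul_eq_iff_eq_mul₀ (by positivity), eq_div_iff hq.ne']
    constructor <;> intro h <;> linear_combination -h
  rw [hquad]
  refine ⟨eq_of_quadratic_eq (randersDen_pos hp) (randers_quadratic hp y)
    (randersRoot_pos hp hy).le (by positivity) ht, ?_⟩
  rintro rfl
  exact randers_quadratic hp y

theorem alpha_smul (p y : Coord 2) {t : ℝ} (ht : 0 ≤ t) :
    alpha ε p (t • y) = t * alpha ε p y := by
  have hsq : ε ^ 2 * klein p (rot p) (t • y) ^ 2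
      + klein p (t • y) (t • y) * (1 - ε ^ 2 * klein p (rot p) (rot p))
      = t ^ 2 * (ε ^ 2 * klein p (rot p) y ^ 2
        + klein p y y * (1 - ε ^ 2 * klein p (rot p) (rot p))) := by
    simp only [klein, PiLp.smul_apply, smul_eq_mul]
    ring
  rw [alpha, alpha, hsq, Real.sqrt_mul (sq_nonneg t), Real.sqrt_sq ht, mul_div_assoc]

theorem beta_smul (p y : Coord 2) (t : ℝ) : beta ε p (t • y) = t * beta ε p y := by
  simp only [beta, klein, PiLp.smul_apply, smul_eq_mul]
  ring

theorem randers_smul (p y : Coord 2) {t : ℝ} (ht : 0 ≤ t) :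
    randers ε p (t • y) = t * randers ε p y := by
  rw [randers, randers, alpha_smul p y ht, beta_smul, mul_add]

theorem randers_zero (p : Coord 2) : randers ε p 0 = 0 := by
  simpa using randers_smul (ε := ε) p 0 le_rfl

theorem contDiff_rot : ContDiff ℝ ∞ rot := by
  rw [contDiff_euclidean]
  intro i
  fin_cases i
  · exact (by fun_prop : ContDiff ℝ ∞ fun p : Coord 2 => -(p 1))
  · exact (by fun_prop : ContDiff ℝ ∞ fun p : Coord 2 => p 0)

theorem contDiff_kleinDen : ContDiff ℝ ∞ kleinDen :=
  contDiff_const.sub (contDiff_norm_sq ℝ)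

theorem contDiff_randersDen (ε : ℝ) : ContDiff ℝ ∞ (randersDen ε) :=
  contDiff_const.sub (contDiff_const.mul (contDiff_norm_sq ℝ))

theorem smoothOn_randers (ε : ℝ) : SmoothOn (randers ε) (slit (disk ε)) := by
  have hq : ContDiff ℝ ∞ fun z : Coord 2 × Coord 2 => kleinDen z.1 :=
    contDiff_kleinDen.comp contDiff_fst
  have hD : ContDiff ℝ ∞ fun z : Coord 2 × Coord 2 => randersDen ε z.1 :=
    (contDiff_randersDen ε).comp contDiff_fst
  have hc : ContDiff ℝ ∞ fun z : Coord 2 × Coord 2 => ⟪rot z.1, z.2⟫ :=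
    (contDiff_rot.comp contDiff_fst).inner ℝ contDiff_snd
  have hK : ContDiff ℝ ∞ fun z : Coord 2 × Coord 2 => kleinForm z.1 z.2 z.2 :=
    (hq.mul (contDiff_snd.inner ℝ contDiff_snd)).add
      ((contDiff_fst.inner ℝ contDiff_snd).mul (contDiff_fst.inner ℝ contDiff_snd))
  have hdisc : ContDiffOn ℝ ∞ (fun z : Coord 2 × Coord 2 => randersDisc ε z.1 z.2)
      (slit (disk ε)) :=
    (contDiff_const.mul (hc.pow 2)).contDiffOn.add
      ((hD.mul hK).contDiffOn.div hq.contDiffOn fun z hz => (kleinDen_pos hz.1).ne')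
  have hsqrt := hdisc.sqrt fun z hz => (randersDisc_pos hz.1 hz.2).ne'
  exact ((hsqrt.sub (contDiff_const.mul hc).contDiffOn).div hD.contDiffOn
    fun z hz => (randersDen_pos hz.1).ne').congr fun z hz => randers_eq hz.1 z.2

end Randers

section RandersType

variable {ε : ℝ} {p : Coord 2}

theorem randersDisc_eq (hp : p ∈ disk ε) (y : Coord 2) : randersDisc ε p y =
    kleinDen p * ‖y‖ ^ 2 + (kleinDen p - ε ^ 2) / kleinDen p * ⟪p, y⟫ ^ 2 := by
  have := kleinDen_pos hp
  rw [randersDisc]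
  field_simp
  simp only [kleinForm, kleinDen, randersDen, real_inner_eq, norm_sq_eq, rot_apply_zero,
    rot_apply_one]
  ring

theorem alphaCoeff_eq (hp : p ∈ disk ε) (i j : Fin 2) :
    alphaCoeff ε p i j = kleinDen p / randersDen ε p ^ 2 * (if i = j then 1 else 0)
      + (kleinDen p - ε ^ 2) / (kleinDen p * randersDen ε p ^ 2) * (p i * p j) := by
  have hq := kleinDen_pos hp
  have hD := randersDen_pos hp
  rw [alphaCoeff, Matrix.of_apply, one_sub_klein_rot hp, klein_rot hp, klein_rot hp, klein_eq]
  field_simp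
  simp only [kleinForm, kleinDen, randersDen, real_inner_eq, norm_sq_eq, rot_apply_zero,
    rot_apply_one, e_apply]
  fin_cases i <;> fin_cases j <;>
    simp only [Fin.zero_eta, Fin.mk_one, Fin.isValue, if_true, zero_ne_one, one_ne_zero,
      if_false] <;>
    ring

theorem sum_alphaCoeff_mul (hp : p ∈ disk ε) (y : Coord 2) :
    ∑ i, ∑ j, alphaCoeff ε p i j * y i * y j = randersDisc ε p y / randersDen ε p ^ 2 := by
  have hq := kleinDen_pos hp
  have hD := randersDen_pos hp
  simp only [alphaCoeff_eq hp, randersDisc_eq hp, Fin.sum_univ_two, real_inner_eq, norm_sq_eq,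
    Fin.isValue, if_true, zero_ne_one, one_ne_zero, if_false]
  field_simp
  ring

theorem posDef_alphaCoeff (hp : p ∈ disk ε) : (alphaCoeff ε p).PosDef := by
  refine Matrix.PosDef.of_dotProduct_mulVec_pos ?_ fun v hv => ?_
  · ext i j
    simp only [Matrix.conjTranspose_apply, star_trivial, alphaCoeff_eq hp, eq_comm, mul_comm (p i)]
  · have hpos : 0 < ∑ i, ∑ j, alphaCoeff ε p i j * v i * v j :=
      sum_alphaCoeff_mul hp (WithLp.toLp 2 v) ▸
        div_pos (randersDisc_pos hp (by simpa using hv)) (pow_pos (randersDen_pos hp) 2)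
    refine hpos.trans_eq ?_
    simp only [dotProduct, Matrix.mulVec, Pi.star_apply, star_trivial, Finset.mul_sum]
    exact Finset.sum_congr rfl fun i _ => Finset.sum_congr rfl fun j _ => by ring

theorem contDiffOn_alphaCoeff (ε : ℝ) (i j : Fin 2) :
    ContDiffOn ℝ ∞ (fun p => alphaCoeff ε p i j) (disk ε) := by
  have hq : ContDiffOn ℝ ∞ kleinDen (disk ε) := contDiff_kleinDen.contDiffOn
  have hD := (contDiff_randersDen ε).contDiffOn (s := disk ε)
  refine ContDiffOn.congr ?_ fun p hp => alphaCoeff_eq hp i j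
  refine ((hq.div (hD.pow 2) fun p hp => (pow_pos (randersDen_pos hp) 2).ne').mul
    contDiffOn_const).add (((hq.sub contDiffOn_const).div (hq.mul (hD.pow 2)) fun p hp =>
      (mul_pos (kleinDen_pos hp) (pow_pos (randersDen_pos hp) 2)).ne').mul ?_)
  fun_prop

theorem contDiffOn_betaCoeff (ε : ℝ) (i : Fin 2) :
    ContDiffOn ℝ ∞ (fun p => betaCoeff ε p i) (disk ε) :=
  ((((contDiff_const (c := ε)).mul (contDiff_rot.inner ℝ contDiff_const)).contDiffOn.div
    (contDiff_randersDen ε).contDiffOn fun _ hp => (randersDen_pos hp).ne').neg).congr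
      fun _ hp => beta_eq hp (e i)

theorem inner_rot_sq_le (hp : p ∈ disk ε) (y : Coord 2) :
    ⟪rot p, y⟫ ^ 2 ≤ ‖p‖ ^ 2 / kleinDen p * randersDisc ε p y := by
  have hq := kleinDen_pos hp
  have hD := randersDen_pos hp
  have hdiff : ‖p‖ ^ 2 / kleinDen p * randersDisc ε p y - ⟪rot p, y⟫ ^ 2 =
      randersDen ε p * ⟪p, y⟫ ^ 2 / kleinDen p ^ 2 := by
    rw [randersDisc]
    field_simp
    simp only [kleinForm, kleinDen, randersDen, real_inner_eq, norm_sq_eq, rot_apply_zero,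
      rot_apply_one]
    ring
  have : 0 ≤ randersDen ε p * ⟪p, y⟫ ^ 2 / kleinDen p ^ 2 := by positivity
  linarith

theorem exists_beta_le_mul_alpha (hp : p ∈ disk ε) :
    ∃ k : ℝ, k < 1 ∧ ∀ y, beta ε p y ≤ k * alpha ε p y := by
  have hq := kleinDen_pos hp
  have hD := randersDen_pos hp
  refine ⟨√(ε ^ 2 * ‖p‖ ^ 2 / kleinDen p), ?_, fun y => ?_⟩
  · rw [Real.sqrt_lt' one_pos, one_pow, div_lt_one hq]
    linarith [kleinDen_eq ε p]
  · rw [beta_eq hp, alpha_eq hp, ← mul_div_assoc, ← neg_div, ← Real.sqrt_mul (by positivity)]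
    refine div_le_div_of_nonneg_right (Real.le_sqrt_of_sq_le ?_) hD.le
    calc (-(ε * ⟪rot p, y⟫)) ^ 2 = ε ^ 2 * ⟪rot p, y⟫ ^ 2 := by ring
      _ ≤ ε ^ 2 * (‖p‖ ^ 2 / kleinDen p * randersDisc ε p y) := by
          gcongr
          exact inner_rot_sq_le hp y
      _ = ε ^ 2 * ‖p‖ ^ 2 / kleinDen p * randersDisc ε p y := by ring

theorem isRandersOn_randers (ε : ℝ) : IsRandersOn (disk ε) (alphaCoeff ε) (betaCoeff ε)
    (alpha ε) (beta ε) (randers ε) where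
  riemannian :=
    { smooth := contDiffOn_alphaCoeff ε
      posDef := fun _ hp => posDef_alphaCoeff hp
      eq_sqrt := fun p hp y => by
        rw [sum_alphaCoeff_mul hp, alpha_eq hp, Real.sqrt_div (randersDisc_nonneg hp y),
          Real.sqrt_sq (randersDen_pos hp).le] }
  smooth := contDiffOn_betaCoeff ε
  oneForm p hp y := by
    simp only [betaCoeff, beta_eq hp, Fin.sum_univ_two, real_inner_eq, e_apply, Fin.isValue,
      if_true, zero_ne_one, one_ne_zero, if_false]
    ring
  norm_lt_one _ hp := exists_beta_le_mul_alpha hp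
  eq_sum _ _ _ := rfl

end RandersType

theorem inner_e_right {n : ℕ} (x : Coord n) (i : Fin n) : ⟪x, e i⟫ = x i := by
  rw [e, EuclideanSpace.inner_single_right]
  simp

theorem hasDirDerivAt_fst {n : ℕ} (i : Fin n) (z v : Coord n × Coord n) :
    HasDirDerivAt (fun z : Coord n × Coord n => z.1 i) (v.1 i) z v :=
  HasDirDerivAt.clm ((EuclideanSpace.proj i : Coord n →L[ℝ] ℝ).comp
    (ContinuousLinearMap.fst ℝ (Coord n) (Coord n)))

theorem hasDirDerivAt_snd {n : ℕ} (i : Fin n) (z v : Coord n × Coord n) :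
    HasDirDerivAt (fun z : Coord n × Coord n => z.2 i) (v.2 i) z v :=
  HasDirDerivAt.clm ((EuclideanSpace.proj i : Coord n →L[ℝ] ℝ).comp
    (ContinuousLinearMap.snd ℝ (Coord n) (Coord n)))

section RandersDerivatives

variable {ε : ℝ} {x y : Coord 2}

theorem hasDirDerivAt_inner (z v : Coord 2 × Coord 2) :
    HasDirDerivAt (fun z : Coord 2 × Coord 2 => ⟪z.1, z.2⟫) (⟪v.1, z.2⟫ + ⟪z.1, v.2⟫) z v := by
  have hx (i : Fin 2) := hasDirDerivAt_fst i z v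
  have hy (i : Fin 2) := hasDirDerivAt_snd i z v
  simp only [real_inner_eq]
  exact (((hx 0).mul (hy 0)).add ((hx 1).mul (hy 1))).congr_deriv (by ring)

theorem hasDirDerivAt_kleinDen (z v : Coord 2 × Coord 2) :
    HasDirDerivAt (fun z : Coord 2 × Coord 2 => kleinDen z.1) (-2 * ⟪z.1, v.1⟫) z v := by
  have h (i : Fin 2) := (hasDirDerivAt_fst i z v).pow_two
  simp only [kleinDen, norm_sq_eq]
  refine ((HasDirDerivAt.const 1).sub ((h 0).add (h 1))).congr_deriv ?_
  rw [real_inner_eq]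
  ring

theorem hasDirDerivAt_randersDen (ε : ℝ) (z v : Coord 2 × Coord 2) :
    HasDirDerivAt (fun z : Coord 2 × Coord 2 => randersDen ε z.1)
      (-2 * (1 + ε ^ 2) * ⟪z.1, v.1⟫) z v := by
  have hD (x : Coord 2) : randersDen ε x = (1 + ε ^ 2) * kleinDen x + -ε ^ 2 := by
    rw [randersDen, kleinDen]
    ring
  simp only [hD]
  exact (((hasDirDerivAt_kleinDen z v).const_mul _).add (.const _)).congr_deriv (by ring)

theorem hasDirDerivAt_inner_rot (z v : Coord 2 × Coord 2) :
    HasDirDerivAt (fun z : Coord 2 × Coord 2 => ⟪rot z.1, z.2⟫)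
      (⟪rot v.1, z.2⟫ + ⟪rot z.1, v.2⟫) z v := by
  have hx (i : Fin 2) := hasDirDerivAt_fst i z v
  have hy (i : Fin 2) := hasDirDerivAt_snd i z v
  simp only [real_inner_eq, rot_apply_zero, rot_apply_one]
  exact (((hx 1).neg.mul (hy 0)).add ((hx 0).mul (hy 1))).congr_deriv (by ring)

theorem hasDirDerivAt_kleinForm (z v : Coord 2 × Coord 2) :
    HasDirDerivAt (fun z : Coord 2 × Coord 2 => kleinForm z.1 z.2 z.2)
      (2 * (kleinForm z.1 z.2 v.2 + (⟪z.1, z.2⟫ * ⟪v.1, z.2⟫ - ⟪z.1, v.1⟫ * ‖z.2‖ ^ 2))) z v := by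
  have hy (i : Fin 2) := hasDirDerivAt_snd i z v
  have hinner := hasDirDerivAt_inner z v
  have hnorm : HasDirDerivAt (fun z : Coord 2 × Coord 2 => ⟪z.2, z.2⟫) (2 * ⟪z.2, v.2⟫) z v := by
    simp only [real_inner_eq]
    exact (((hy 0).mul (hy 0)).add ((hy 1).mul (hy 1))).congr_deriv (by ring)
  refine (((hasDirDerivAt_kleinDen z v).mul hnorm).add (hinner.mul hinner)).congr_deriv ?_
  rw [kleinForm, real_inner_self_eq_norm_sq]
  ring

/-- The velocity `y - F • (ε v)` relative to the wind `ε v`, where `v = rot x`. -/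
def airVelocity (ε : ℝ) (x y : Coord 2) : Coord 2 := y - (ε * randers ε x y) • rot x

/-- The projective factor `P` of the Klein metric, whose spray coefficients are `P y^i`. -/
def kleinFactor (x y : Coord 2) : ℝ := ⟪x, y⟫ / kleinDen x

/-- The vector representing the covector dual to `airVelocity` under the Klein metric, scaled by
`1 - |x|²`. -/
def airCovector (ε : ℝ) (x y : Coord 2) : Coord 2 := airVelocity ε x y + kleinFactor x y • x

theorem kleinDen_mul_kleinFactor (hp : x ∈ disk ε) (y : Coord 2) :
    kleinDen x * kleinFactor x y = ⟪x, y⟫ :=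
  mul_div_cancel₀ _ (kleinDen_pos hp).ne'

theorem inner_airVelocity (ε : ℝ) (x y : Coord 2) : ⟪x, airVelocity ε x y⟫ = ⟪x, y⟫ := by
  rw [airVelocity, inner_sub_right, real_inner_smul_right, inner_rot_self, mul_zero, sub_zero]

theorem kleinForm_airVelocity (hp : x ∈ disk ε) (y b : Coord 2) :
    kleinForm x (airVelocity ε x y) b = kleinDen x * ⟪airCovector ε x y, b⟫ := by
  rw [kleinForm, inner_airVelocity, airCovector, inner_add_left, real_inner_smul_left,
    ← kleinDen_mul_kleinFactor hp]
  ring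

theorem rot_airVelocity (ε : ℝ) (x y : Coord 2) :
    rot (airVelocity ε x y) = rot y + (ε * randers ε x y) • x := by
  rw [airVelocity, rot_sub, rot_smul, rot_rot, smul_neg, sub_neg_eq_add]

theorem rot_airCovector (ε : ℝ) (x y : Coord 2) :
    rot (airCovector ε x y) = rot (airVelocity ε x y) + kleinFactor x y • rot x := by
  rw [airCovector, rot_add, rot_smul]

theorem randers_quadratic_eq_norm_sq (hp : x ∈ disk ε) (y : Coord 2) :
    randersDen ε x * randers ε x y ^ 2 + 2 * (ε * ⟪rot x, y⟫) * randers ε x y =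
      ‖y‖ ^ 2 + ⟪x, y⟫ * kleinFactor x y := by
  have := kleinDen_pos hp
  rw [randers_quadratic hp, kleinForm, kleinFactor, real_inner_self_eq_norm_sq]
  field_simp

theorem randersRoot_mul_fderiv_randers (h : (x, y) ∈ slit (disk ε)) (a b : Coord 2) :
    randersRoot ε x y * fderiv ℝ (uncurry (randers ε)) (x, y) (a, b) =
      ⟪airCovector ε x y, b⟫ + randers ε x y ^ 2 * ⟪x, a⟫
        + kleinFactor x y * ⟪airCovector ε x y, a⟫
        + ε * randers ε x y * ⟪rot (airCovector ε x y), a⟫ := by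
  have hΩ := isOpen_slit (isOpen_disk ε)
  have hF := (smoothOn_randers ε).hasDirDerivAt_fderiv hΩ h (a, b)
  have hquad := (hasDirDerivAt_kleinDen (x, y) (a, b)).mul
    (((hasDirDerivAt_randersDen ε (x, y) (a, b)).mul hF.pow_two).add
      ((((hasDirDerivAt_inner_rot (x, y) (a, b)).const_mul ε).const_mul 2).mul hF))
  have hK := hquad.unique <| (hasDirDerivAt_kleinForm (x, y) (a, b)).congr_of_eventuallyEq <|
    eventuallyEq_of_mem (hΩ.mem_nhds h) fun z hz => by
      simp only [uncurry]
      rw [randers_quadratic hz.1, mul_div_cancel₀ _ (kleinDen_pos hz.1).ne']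
  have hb := kleinForm_airVelocity h.1 y b
  rw [airVelocity, kleinForm_sub_smul_rot_left] at hb
  have hw : ⟪airCovector ε x y, a⟫ =
      ⟪y, a⟫ - ε * randers ε x y * ⟪rot x, a⟫ + kleinFactor x y * ⟪x, a⟫ := by
    simp only [airCovector, airVelocity, inner_add_left, inner_sub_left, real_inner_smul_left]
  have hrw : ⟪rot (airCovector ε x y), a⟫ =
      ⟪rot y, a⟫ + ε * randers ε x y * ⟪x, a⟫ + kleinFactor x y * ⟪rot x, a⟫ := by
    simp only [rot_airCovector, rot_airVelocity, inner_add_left, real_inner_smul_left]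
  simp only [uncurry, inner_rot_left a, real_inner_comm _ a] at hK
  rw [hw, hrw, randersRoot]
  refine mul_left_cancel₀ (kleinDen_pos h.1).ne' ?_
  linear_combination hK / 2 + hb + ⟪x, a⟫ * randers_quadratic_eq_norm_sq h.1 y
    - (⟪y, a⟫ + kleinFactor x y * ⟪x, a⟫) * kleinDen_mul_kleinFactor h.1 y

theorem randersRoot_mul_dY (h : (x, y) ∈ slit (disk ε)) (i : Fin 2) :
    randersRoot ε x y * dY (randers ε) i x y = airCovector ε x y i := by
  rw [(smoothOn_randers ε).dY_eq (isOpen_slit (isOpen_disk ε)) h,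
    randersRoot_mul_fderiv_randers h]
  simp [inner_e_right]

theorem randersRoot_mul_dX (h : (x, y) ∈ slit (disk ε)) (k : Fin 2) :
    randersRoot ε x y * dX (randers ε) k x y =
      randers ε x y ^ 2 * x k + kleinFactor x y * airCovector ε x y k
        + ε * randers ε x y * rot (airCovector ε x y) k := by
  rw [(smoothOn_randers ε).dX_eq (isOpen_slit (isOpen_disk ε)) h,
    randersRoot_mul_fderiv_randers h]
  simp [inner_e_right]

theorem randersRoot_mul_dY_dY (h : (x, y) ∈ slit (disk ε)) (i j : Fin 2) :
    randersRoot ε x y * dY (dY (randers ε) i) j x y = e j i + x i * x j / kleinDen x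
      - ε * (dY (randers ε) i x y * rot x j + dY (randers ε) j x y * rot x i)
      - randersDen ε x * (dY (randers ε) i x y * dY (randers ε) j x y) := by
  have hΩ := isOpen_slit (isOpen_disk ε)
  have hF := (smoothOn_randers ε).hasDirDerivAt_right hΩ h j
  have hFi := ((smoothOn_randers ε).dY_smooth hΩ i).hasDirDerivAt_right hΩ h j
  have hinner (a : Coord 2) : HasDirDerivAt (fun y' => ⟪a, y'⟫) (a j) y (e j) :=
    inner_e_right a j ▸ .clm (innerSL ℝ a)
  have hlhs := ((hF.const_mul (randersDen ε x)).add ((hinner (rot x)).const_mul ε)).mul hFi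
  have hrhs := ((hasDirDerivAt_coord i y (e j)).sub ((hF.const_mul ε).mul (.const (rot x i)))).add
    ((hinner x).const_mul (x i / kleinDen x))
  have hij := hlhs.unique <| hrhs.congr_of_eventuallyEq <|
    (eventually_right_mem hΩ h).mono fun y' h' => by
      have hy' := randersRoot_mul_dY h' i
      simp only [randersRoot, airCovector, airVelocity, kleinFactor, PiLp.add_apply,
        PiLp.sub_apply, PiLp.smul_apply, smul_eq_mul] at hy' ⊢
      rw [hy']
      ring
  rw [randersRoot]
  linear_combination hij

theorem sum_sum_mul_dY_dY (h : (x, y) ∈ slit (disk ε)) (u : Coord 2) :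
    kleinDen x * randersRoot ε x y * ∑ i, ∑ j, u i * u j * dY (dY (randers ε) i) j x y =
      kleinForm x (u - (ε * ∑ j, u j * dY (randers ε) j x y) • rot x)
          (u - (ε * ∑ j, u j * dY (randers ε) j x y) • rot x)
        - (kleinDen x * ∑ j, u j * dY (randers ε) j x y) ^ 2 := by
  have hq := (kleinDen_pos h.1).ne'
  have hij (i j : Fin 2) := congr_arg (kleinDen x * ·) (randersRoot_mul_dY_dY h i j)
  rw [kleinForm_sub_smul_rot]
  simp only [kleinForm, real_inner_eq, Fin.sum_univ_two, e_apply, mul_sub, mul_add,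
    mul_div_cancel₀ _ hq] at hij ⊢
  have h00 := hij 0 0
  have h01 := hij 0 1
  have h10 := hij 1 0
  have h11 := hij 1 1
  simp only [Fin.isValue, if_true, zero_ne_one, one_ne_zero, if_false] at h00 h01 h10 h11
  linear_combination u 0 * u 0 * h00 + u 0 * u 1 * h01 + u 1 * u 0 * h10 + u 1 * u 1 * h11

theorem kleinForm_airVelocity_self (hp : x ∈ disk ε) (y : Coord 2) :
    kleinForm x (airVelocity ε x y) (airVelocity ε x y) =
      (kleinDen x * randers ε x y) ^ 2 := by
  rw [airVelocity, kleinForm_sub_smul_rot, randers_quadratic hp,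
    mul_div_cancel₀ _ (kleinDen_pos hp).ne']
  ring

theorem sum_mul_dY_sq_le (h : (x, y) ∈ slit (disk ε)) (u : Coord 2) :
    (kleinDen x * ∑ j, u j * dY (randers ε) j x y) ^ 2 ≤
      kleinForm x (u - (ε * ∑ j, u j * dY (randers ε) j x y) • rot x)
        (u - (ε * ∑ j, u j * dY (randers ε) j x y) • rot x) := by
  set Fu := ∑ j, u j * dY (randers ε) j x y with hFu_def
  have hqF : 0 < kleinDen x * randers ε x y := mul_pos (kleinDen_pos h.1) (randers_pos h.1 h.2)
  have hFu : randersRoot ε x y * Fu = ⟪airCovector ε x y, u⟫ := by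
    rw [hFu_def, real_inner_eq, Fin.sum_univ_two]
    linear_combination u 0 * randersRoot_mul_dY h 0 + u 1 * randersRoot_mul_dY h 1
  have hcross : kleinForm x (airVelocity ε x y) (u - (ε * Fu) • rot x) =
      kleinDen x * randers ε x y * (kleinDen x * Fu) := by
    have hu := kleinForm_airVelocity h.1 y u
    rw [← hFu, randersRoot, airVelocity, kleinForm_sub_smul_rot_left] at hu
    rw [airVelocity, kleinForm_sub_smul_rot_sub_smul_rot]
    linear_combination hu - kleinDen x * randers ε x y * Fu * kleinDen_eq ε x
  have hCS := kleinForm_sq_le (kleinDen_pos h.1) (airVelocity ε x y) (u - (ε * Fu) • rot x)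
  rw [hcross, kleinForm_airVelocity_self h.1, mul_pow] at hCS
  exact le_of_mul_le_mul_left hCS (by positivity)

theorem sum_sum_fundTensor_randers_pos (h : (x, y) ∈ slit (disk ε)) {u : Coord 2} (hu : u ≠ 0) :
    0 < ∑ i, ∑ j, fundTensor (randers ε) x y i j * u i * u j := by
  set F := randers ε x y
  set Fu := ∑ j, u j * dY (randers ε) j x y with hFu
  set Fuu := ∑ i, ∑ j, u i * u j * dY (dY (randers ε) i) j x y with hFuu
  have hq := kleinDen_pos h.1
  have hqM : 0 < kleinDen x * randersRoot ε x y := mul_pos hq (randersRoot_pos h.1 h.2)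
  have hF : 0 < F := randers_pos h.1 h.2
  have hsum : ∑ i, ∑ j, fundTensor (randers ε) x y i j * u i * u j = Fu ^ 2 + F * Fuu := by
    simp only [(smoothOn_randers ε).fundTensor_eq (isOpen_disk ε) h, hFu, hFuu, F,
      Fin.sum_univ_two]
    ring
  have hFuu_eq : kleinDen x * randersRoot ε x y * Fuu =
      kleinForm x (u - (ε * Fu) • rot x) (u - (ε * Fu) • rot x) - (kleinDen x * Fu) ^ 2 :=
    sum_sum_mul_dY_dY h u
  rw [hsum]
  rcases eq_or_ne Fu 0 with hFu0 | hFu0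
  · have hFuu_pos : 0 < kleinDen x * randersRoot ε x y * Fuu := by
      simpa [hFuu_eq, hFu0] using kleinForm_pos hq hu
    have := pos_of_mul_pos_right hFuu_pos hqM.le
    positivity
  · have hFuu_nonneg : 0 ≤ kleinDen x * randersRoot ε x y * Fuu :=
      hFuu_eq ▸ sub_nonneg.2 (sum_mul_dY_sq_le h u)
    have := nonneg_of_mul_nonneg_right hFuu_nonneg hqM
    positivity

theorem isFinslerOn_randers (ε : ℝ) : IsFinslerOn (disk ε) (randers ε) where
  smooth := smoothOn_randers ε
  zero _ _ := randers_zero _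
  pos _ hp _ hy := randers_pos hp hy
  homog _ _ _ _ ht := randers_smul _ _ ht.le
  convex _ hp _ hy _ hu := sum_sum_fundTensor_randers_pos ⟨hp, hy⟩ hu

end RandersDerivatives

section RandersSpray

variable {ε : ℝ} {x y : Coord 2}

theorem HasDirDerivAt.rot {E : Type*} [NormedAddCommGroup E] [NormedSpace ℝ E]
    {f : E → Coord 2} {f' : Coord 2} {z v : E}
    (h : ∀ i, HasDirDerivAt (fun z => f z i) (f' i) z v) (i : Fin 2) :
    HasDirDerivAt (fun z => rot (f z) i) (rot f' i) z v := by
  fin_cases i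
  · exact (h 1).neg
  · exact h 0

theorem hasDirDerivAt_kleinFactor {z : Coord 2 × Coord 2} (hz : kleinDen z.1 ≠ 0)
    (v : Coord 2 × Coord 2) :
    HasDirDerivAt (uncurry kleinFactor)
      ((⟪v.1, z.2⟫ + ⟪z.1, v.2⟫ + 2 * ⟪z.1, v.1⟫ * kleinFactor z.1 z.2) / kleinDen z.1) z v :=
  ((hasDirDerivAt_inner z v).div (hasDirDerivAt_kleinDen z v) hz).congr_deriv (by
    rw [kleinFactor]
    field_simp
    ring)

theorem hasDirDerivAt_airVelocity (h : (x, y) ∈ slit (disk ε)) (v : Coord 2 × Coord 2)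
    (i : Fin 2) :
    HasDirDerivAt (fun z : Coord 2 × Coord 2 => airVelocity ε z.1 z.2 i)
      (v.2 i - ε * (fderiv ℝ (uncurry (randers ε)) (x, y) v * rot x i
        + randers ε x y * rot v.1 i)) (x, y) v := by
  have hF := (smoothOn_randers ε).hasDirDerivAt_fderiv (isOpen_slit (isOpen_disk ε)) h v
  have hrot := HasDirDerivAt.rot (fun j => hasDirDerivAt_fst j (x, y) v) i
  exact ((hasDirDerivAt_snd i _ v).sub ((hF.const_mul ε).mul hrot)).congr_deriv (by
    simp only [uncurry]
    ring)

/-- The spray coefficients of `F`: its unit-speed geodesics are `t ↦ R_{εt} (γ t)`, where `γ` is a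
unit-speed geodesic of the Klein metric and `R_θ` the rotation by `θ`. -/
def randersSpray (ε : ℝ) (i : Fin 2) (x y : Coord 2) : ℝ :=
  kleinFactor x y * airVelocity ε x y i - ε * randers ε x y * rot y i
    - ε ^ 2 / 2 * randers ε x y ^ 2 * x i

theorem hasDirDerivAt_randersSpray (h : (x, y) ∈ slit (disk ε)) (v : Coord 2 × Coord 2)
    (i : Fin 2) :
    HasDirDerivAt (uncurry (randersSpray ε i))
      ((⟪v.1, y⟫ + ⟪x, v.2⟫ + 2 * ⟪x, v.1⟫ * kleinFactor x y) / kleinDen x * airVelocity ε x y i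
        + kleinFactor x y * (v.2 i - ε * randers ε x y * rot v.1 i)
        - ε * fderiv ℝ (uncurry (randers ε)) (x, y) v * rot (airCovector ε x y) i
        - ε * randers ε x y * rot v.2 i - ε ^ 2 / 2 * randers ε x y ^ 2 * v.1 i) (x, y) v := by
  have hF := (smoothOn_randers ε).hasDirDerivAt_fderiv (isOpen_slit (isOpen_disk ε)) h v
  have hP := hasDirDerivAt_kleinFactor (z := (x, y)) (kleinDen_pos h.1).ne' v
  have hrot := HasDirDerivAt.rot (fun j => hasDirDerivAt_snd j (x, y) v) i
  refine (((hP.mul (hasDirDerivAt_airVelocity h v i)).sub ((hF.const_mul ε).mul hrot)).sub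
    ((hF.pow_two.const_mul (ε ^ 2 / 2)).mul (hasDirDerivAt_fst i _ v))).congr_deriv ?_
  simp only [uncurry, rot_airCovector, rot_airVelocity, PiLp.add_apply, PiLp.smul_apply,
    smul_eq_mul]
  ring

theorem smoothOn_kleinFactor (ε : ℝ) : SmoothOn kleinFactor (slit (disk ε)) :=
  ContDiffOn.div (contDiff_fst.inner ℝ contDiff_snd).contDiffOn
    (contDiff_kleinDen.comp contDiff_fst).contDiffOn fun _ hz => (kleinDen_pos hz.1).ne'

theorem smoothOn_randersSpray (ε : ℝ) (i : Fin 2) :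
    SmoothOn (randersSpray ε i) (slit (disk ε)) := by
  have hF : ContDiffOn ℝ ∞ (fun z : Coord 2 × Coord 2 => randers ε z.1 z.2) (slit (disk ε)) :=
    smoothOn_randers ε
  have hP := smoothOn_kleinFactor ε
  have hrotx : ContDiff ℝ ∞ fun z : Coord 2 × Coord 2 => rot z.1 :=
    contDiff_rot.comp contDiff_fst
  have hroty : ContDiff ℝ ∞ fun z : Coord 2 × Coord 2 => rot z.2 :=
    contDiff_rot.comp contDiff_snd
  have hu : ContDiffOn ℝ ∞ (fun z : Coord 2 × Coord 2 => airVelocity ε z.1 z.2)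
      (slit (disk ε)) :=
    contDiff_snd.contDiffOn.sub ((contDiffOn_const.mul hF).smul hrotx.contDiffOn)
  have hcoord {f : Coord 2 × Coord 2 → Coord 2} (hf : ContDiffOn ℝ ∞ f (slit (disk ε))) :
      ContDiffOn ℝ ∞ (fun z => f z i) (slit (disk ε)) := by fun_prop
  exact ((hP.mul (hcoord hu)).sub ((contDiffOn_const.mul hF).mul (hcoord hroty.contDiffOn))).sub
    ((contDiffOn_const.mul (hF.pow 2)).mul (hcoord contDiff_fst.contDiffOn))

theorem dY_randersSpray (h : (x, y) ∈ slit (disk ε)) (i k : Fin 2) :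
    dY (randersSpray ε i) k x y = x k / kleinDen x * airVelocity ε x y i
      + kleinFactor x y * e k i - ε * dY (randers ε) k x y * rot (airCovector ε x y) i
      - ε * randers ε x y * rot (e k) i := by
  have hΩ := isOpen_slit (isOpen_disk ε)
  rw [(smoothOn_randersSpray ε i).dY_eq hΩ h, (hasDirDerivAt_randersSpray h _ i).fderiv_apply,
    (smoothOn_randers ε).dY_eq hΩ h, inner_e_right]
  simp

theorem dX_randersSpray (h : (x, y) ∈ slit (disk ε)) (i k : Fin 2) :
    dX (randersSpray ε i) k x y =
      (y k + 2 * x k * kleinFactor x y) / kleinDen x * airVelocity ε x y i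
        - ε * randers ε x y * kleinFactor x y * rot (e k) i
        - ε * dX (randers ε) k x y * rot (airCovector ε x y) i
        - ε ^ 2 / 2 * randers ε x y ^ 2 * e k i := by
  have hΩ := isOpen_slit (isOpen_disk ε)
  rw [(smoothOn_randersSpray ε i).dX_eq hΩ h, (hasDirDerivAt_randersSpray h _ i).fderiv_apply,
    (smoothOn_randers ε).dX_eq hΩ h, real_inner_comm, inner_e_right, inner_e_right]
  simp only [inner_zero_right, add_zero, PiLp.zero_apply, rot_zero, zero_sub, sub_zero, mul_zero]
  ring

theorem norm_airVelocity_sq (hp : x ∈ disk ε) (y : Coord 2) :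
    ‖airVelocity ε x y‖ ^ 2 = kleinDen x * (randers ε x y ^ 2 - kleinFactor x y ^ 2) := by
  have h := kleinForm_airVelocity_self hp y
  rw [kleinForm, inner_airVelocity, real_inner_self_eq_norm_sq,
    ← kleinDen_mul_kleinFactor hp] at h
  refine mul_left_cancel₀ (kleinDen_pos hp).ne' ?_
  linear_combination h

theorem inner_airCovector_airVelocity (hp : x ∈ disk ε) (y : Coord 2) :
    ⟪airCovector ε x y, airVelocity ε x y⟫ = kleinDen x * randers ε x y ^ 2 := by
  rw [airCovector, inner_add_left, real_inner_smul_left, real_inner_self_eq_norm_sq,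
    norm_airVelocity_sq hp, inner_airVelocity, ← kleinDen_mul_kleinFactor hp]
  ring

theorem isSprayOn_randersSpray (ε : ℝ) : IsSprayOn (disk ε) (randers ε) (randersSpray ε) where
  smooth := smoothOn_randersSpray ε
  euler x hx y hy i := by
    have hE := (isFinslerOn_randers ε).euler (isOpen_disk ε) ⟨hx, hy⟩
    have hkp := kleinDen_mul_kleinFactor hx y
    have hq := (kleinDen_pos hx).ne'
    have hsum_e : y 0 * e 0 i + y 1 * e 1 i = y i := by fin_cases i <;> simp
    have hsum_rot : y 0 * rot (e 0) i + y 1 * rot (e 1) i = rot y i := by fin_cases i <;> simp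
    have hu : airVelocity ε x y i = y i - ε * randers ε x y * rot x i := rfl
    rw [real_inner_eq] at hkp
    simp only [Fin.sum_univ_two, dY_randersSpray ⟨hx, hy⟩, randersSpray, rot_airCovector,
      rot_airVelocity, PiLp.add_apply, PiLp.smul_apply, smul_eq_mul] at hE ⊢
    linear_combination (norm := (field_simp; ring))
      (-ε * (rot y i + kleinFactor x y * rot x i + ε * randers ε x y * x i)) * hE
      - airVelocity ε x y i / kleinDen x * hkp + kleinFactor x y * hsum_e
      - ε * randers ε x y * hsum_rot - kleinFactor x y * hu
  horizontal x hx y hy k := by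
    have hM := (randersRoot_pos hx hy).ne'
    have hwu := inner_airCovector_airVelocity hx y
    have hq := (kleinDen_pos hx).ne'
    have hrot : airCovector ε x y 0 * rot (e k) 0 + airCovector ε x y 1 * rot (e k) 1 =
        -rot (airCovector ε x y) k := by fin_cases k <;> simp
    have hsum_e : airCovector ε x y 0 * e k 0 + airCovector ε x y 1 * e k 1 =
        airCovector ε x y k := by fin_cases k <;> simp
    refine mul_left_cancel₀ hM ?_
    rw [real_inner_eq] at hwu
    rw [Fin.sum_univ_two, mul_add, mul_left_comm, randersRoot_mul_dY ⟨hx, hy⟩, mul_left_comm,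
      randersRoot_mul_dY ⟨hx, hy⟩, randersRoot_mul_dX ⟨hx, hy⟩]
    simp only [dY_randersSpray ⟨hx, hy⟩, rot_apply_zero (airCovector ε x y),
      rot_apply_one (airCovector ε x y)]
    linear_combination (norm := (field_simp; ring)) -x k / kleinDen x * hwu
      - kleinFactor x y * hsum_e + ε * randers ε x y * hrot

theorem hasDirDerivAt_airVelocity_geodesicField (h : (x, y) ∈ slit (disk ε)) (i : Fin 2) :
    HasDirDerivAt (fun z : Coord 2 × Coord 2 => airVelocity ε z.1 z.2 i)
      (-2 * kleinFactor x y * airVelocity ε x y i + ε * randers ε x y * rot (airVelocity ε x y) i)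
      (x, y) (geodesicField (randersSpray ε) x y) := by
  have hF0 := (isSprayOn_randersSpray ε).sprayDeriv_eq_zero (smoothOn_randers ε) (isOpen_disk ε) h
  refine (hasDirDerivAt_airVelocity h _ i).congr_deriv ?_
  rw [sprayDeriv] at hF0
  rw [hF0, rot_airVelocity]
  simp only [geodesicField, randersSpray, PiLp.add_apply, PiLp.smul_apply, smul_eq_mul]
  ring

theorem hasDirDerivAt_kleinFactor_geodesicField (h : (x, y) ∈ slit (disk ε)) :
    HasDirDerivAt (uncurry kleinFactor) (randers ε x y ^ 2 - kleinFactor x y ^ 2)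
      (x, y) (geodesicField (randersSpray ε) x y) := by
  refine (hasDirDerivAt_kleinFactor (z := (x, y)) (kleinDen_pos h.1).ne' _).congr_deriv ?_
  have hG : ⟪x, (geodesicField (randersSpray ε) x y).2⟫ =
      -2 * (kleinFactor x y * ⟪x, y⟫ - ε * randers ε x y * ⟪x, rot y⟫
        - ε ^ 2 / 2 * randers ε x y ^ 2 * ‖x‖ ^ 2) := by
    rw [← inner_airVelocity ε x y, real_inner_eq, real_inner_eq, real_inner_eq, norm_sq_eq]
    simp only [geodesicField, randersSpray]
    ring
  have hu : ‖y‖ ^ 2 + 2 * ε * randers ε x y * ⟪x, rot y⟫ + (ε * randers ε x y) ^ 2 * ‖x‖ ^ 2 =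
      kleinDen x * (randers ε x y ^ 2 - kleinFactor x y ^ 2) := by
    rw [← norm_airVelocity_sq h.1, airVelocity, norm_sq_eq, norm_sq_eq, norm_sq_eq, real_inner_eq]
    simp only [PiLp.sub_apply, PiLp.smul_apply, smul_eq_mul, rot_apply_zero, rot_apply_one]
    ring
  rw [div_eq_iff (kleinDen_pos h.1).ne', hG]
  simp only [geodesicField, real_inner_self_eq_norm_sq]
  linear_combination hu

theorem hasDirDerivAt_airCovector_geodesicField (h : (x, y) ∈ slit (disk ε)) (i : Fin 2) :
    HasDirDerivAt (fun z : Coord 2 × Coord 2 => airCovector ε z.1 z.2 i)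
      ((-kleinFactor x y • airCovector ε x y + (ε * randers ε x y) • rot (airCovector ε x y)
        + randers ε x y ^ 2 • x) i) (x, y) (geodesicField (randersSpray ε) x y) := by
  refine ((hasDirDerivAt_airVelocity_geodesicField h i).add
    ((hasDirDerivAt_kleinFactor_geodesicField h).mul (hasDirDerivAt_fst i _ _))).congr_deriv ?_
  have hy : y i = airVelocity ε x y i + ε * randers ε x y * rot x i := by
    simp [airVelocity]
  simp only [uncurry, geodesicField, hy, rot_airCovector, PiLp.add_apply, PiLp.smul_apply,
    smul_eq_mul]
  simp only [airCovector, PiLp.add_apply, PiLp.smul_apply, smul_eq_mul]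
  ring

theorem sprayDeriv_dY_randersSpray (h : (x, y) ∈ slit (disk ε)) (i k : Fin 2) :
    sprayDeriv (randersSpray ε) (dY (randersSpray ε i) k) x y =
      (y k + 2 * kleinFactor x y * x k) / kleinDen x * airVelocity ε x y i
        + x k / kleinDen x * (-2 * kleinFactor x y * airVelocity ε x y i
          + ε * randers ε x y * rot (airVelocity ε x y) i)
        + (randers ε x y ^ 2 - kleinFactor x y ^ 2) * e k i
        - ε * dX (randers ε) k x y * rot (airCovector ε x y) i
        - ε * dY (randers ε) k x y * (-kleinFactor x y * rot (airCovector ε x y) i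
          - ε * randers ε x y * airCovector ε x y i + randers ε x y ^ 2 * rot x i) := by
  have hΩ := isOpen_slit (isOpen_disk ε)
  have hF := smoothOn_randers ε
  have hG := isSprayOn_randersSpray ε
  set ξ := geodesicField (randersSpray ε) x y
  have hSF := (hF.hasDirDerivAt_fderiv hΩ h ξ).congr_deriv
    (hG.sprayDeriv_eq_zero hF (isOpen_disk ε) h)
  have hSFk := ((hF.dY_smooth hΩ k).hasDirDerivAt_fderiv hΩ h ξ).congr_deriv
    (hG.sprayDeriv_dY hF (isOpen_disk ε) h k)
  have hξ := (hasDirDerivAt_fst k (x, y) ξ).div (hasDirDerivAt_kleinDen (x, y) ξ)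
    (kleinDen_pos h.1).ne'
  have hu := hasDirDerivAt_airVelocity_geodesicField h i
  have hkp := hasDirDerivAt_kleinFactor_geodesicField h
  have hw := HasDirDerivAt.rot (hasDirDerivAt_airCovector_geodesicField h) i
  have hN := (((hξ.mul hu).add (hkp.mul (.const (e k i)))).sub
    ((hSFk.const_mul ε).mul hw)).sub ((hSF.const_mul ε).mul (.const (rot (e k) i)))
  refine (hN.congr_of_eventuallyEq (eventuallyEq_of_mem (hΩ.mem_nhds h)
    fun z hz => dY_randersSpray hz i k)).fderiv_apply.trans ?_
  have hxi : ⟪x, ξ.1⟫ = kleinDen x * kleinFactor x y := (kleinDen_mul_kleinFactor h.1 y).symm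
  simp only [uncurry, hxi, rot_add, rot_smul, rot_rot, PiLp.add_apply, PiLp.smul_apply,
    PiLp.neg_apply, smul_eq_mul]
  simp only [ξ, geodesicField]
  have hq := (kleinDen_pos h.1).ne'
  field_simp
  ring

theorem sum_dY_mul_dY_randersSpray (h : (x, y) ∈ slit (disk ε)) (i k : Fin 2) :
    ∑ j, dY (randersSpray ε i) j x y * dY (randersSpray ε j) k x y =
      (2 * kleinFactor x y * x k - ε * dY (randers ε) k x y * ⟪x, rot (airCovector ε x y)⟫
          + ε * randers ε x y * rot x k) / kleinDen x * airVelocity ε x y i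
        + kleinFactor x y * dY (randersSpray ε i) k x y
        - ε * dX (randers ε) k x y * rot (airCovector ε x y) i
        - ε * randers ε x y * (x k / kleinDen x * rot (airVelocity ε x y) i
          + kleinFactor x y * rot (e k) i + ε * dY (randers ε) k x y * airCovector ε x y i
          + ε * randers ε x y * e k i) := by
  have hX := (isSprayOn_randersSpray ε).horizontal x h.1 y h.2 k
  have hx : x 0 * dY (randersSpray ε 0) k x y + x 1 * dY (randersSpray ε 1) k x y =
      2 * kleinFactor x y * x k - ε * dY (randers ε) k x y * ⟪x, rot (airCovector ε x y)⟫
        + ε * randers ε x y * rot x k := by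
    have hkp := kleinDen_mul_kleinFactor h.1 y
    have hq := (kleinDen_pos h.1).ne'
    have hxe : x 0 * e k 0 + x 1 * e k 1 = x k := by fin_cases k <;> simp
    have hxrot : x 0 * rot (e k) 0 + x 1 * rot (e k) 1 = -rot x k := by fin_cases k <;> simp
    rw [← inner_airVelocity ε x y, real_inner_eq] at hkp
    simp only [dY_randersSpray h, real_inner_eq]
    linear_combination (norm := (field_simp; ring)) -x k / kleinDen x * hkp
      + kleinFactor x y * hxe - ε * randers ε x y * hxrot
  have he : e 0 i * dY (randersSpray ε 0) k x y + e 1 i * dY (randersSpray ε 1) k x y =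
      dY (randersSpray ε i) k x y := by fin_cases i <;> simp
  have hrot : rot (e 0) i * dY (randersSpray ε 0) k x y
      + rot (e 1) i * dY (randersSpray ε 1) k x y =
      x k / kleinDen x * rot (airVelocity ε x y) i + kleinFactor x y * rot (e k) i
        + ε * dY (randers ε) k x y * airCovector ε x y i + ε * randers ε x y * e k i := by
    simp only [dY_randersSpray h]
    fin_cases i
    · simp
      ring
    · simp
  rw [Fin.sum_univ_two] at hX ⊢
  rw [dY_randersSpray h i 0, dY_randersSpray h i 1, ← hx, ← hrot, hX]
  linear_combination kleinFactor x y * he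

theorem hasConstCurvatureOn_randers (ε : ℝ) : HasConstCurvatureOn (disk ε) (randers ε) (-1) := by
  intro x hx y hy i k
  have h : (x, y) ∈ slit (disk ε) := ⟨hx, hy⟩
  have hq := (kleinDen_pos hx).ne'
  have hM : randersRoot ε x y + ε * ⟪x, rot (airCovector ε x y)⟫ =
      kleinDen x * randers ε x y := by
    rw [randersRoot, rot_airCovector, rot_airVelocity, inner_add_right, inner_add_right,
      real_inner_smul_right, real_inner_smul_right, inner_rot_self, inner_rot_left,
      real_inner_self_eq_norm_sq]
    linear_combination -randers ε x y * kleinDen_eq ε x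
  have hwk := randersRoot_mul_dY h k
  have hy_eq (j : Fin 2) : y j = airVelocity ε x y j + ε * randers ε x y * rot x j := by
    simp [airVelocity]
  have hw (j : Fin 2) : airCovector ε x y j = airVelocity ε x y j + kleinFactor x y * x j := rfl
  rw [(isSprayOn_randersSpray ε).riemCurv_eq (isFinslerOn_randers ε) (isOpen_disk ε) h,
    dX_randersSpray h, sprayDeriv_dY_randersSpray h, sum_dY_mul_dY_randersSpray h,
    dY_randersSpray h, ← e_apply, hy_eq i]
  change _ = -1 * (_ - _ * dY (randers ε) k x y * _)
  linear_combination (norm := (field_simp; ring)) airVelocity ε x y i / kleinDen x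
    * (dY (randers ε) k x y * hM - hwk + hy_eq k - hw k)

end RandersSpray

section BusemannHausdorff

open MeasureTheory Matrix
open scoped MatrixOrder

theorem volume_setOf_dotProduct_mulVec_lt_one {n : ℕ} {A : Matrix (Fin n) (Fin n) ℝ}
    (hA : A.PosDef) (w : Coord n) :
    volume {y : Coord n | (y - w).ofLp ⬝ᵥ A *ᵥ (y - w).ofLp < 1} =
      ENNReal.ofReal (√A.det)⁻¹ * volume (Metric.ball (0 : Coord n) 1) := by
  set B := CFC.sqrt A
  have hBB : B * B = A := CFC.sqrt_mul_sqrt_self A hA.posSemidef.nonneg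
  have hBT : Bᵀ = B := (CFC.sqrt_nonneg A).posSemidef.isHermitian
  have hdet : |LinearMap.det (toEuclideanLin B)| = √A.det := by
    rw [← hBB, det_mul, Real.sqrt_mul_self_eq_abs]
    exact congrArg _ (LinearMap.det_toLpLin 2 B)
  have hset : {y : Coord n | (y - w).ofLp ⬝ᵥ A *ᵥ (y - w).ofLp < 1} =
      (· + -w) ⁻¹' (toEuclideanLin B ⁻¹' Metric.ball 0 1) := by
    ext y
    rw [Set.mem_preimage, Set.mem_preimage, mem_ball_zero_iff, ← sub_eq_add_neg,
      ← sq_lt_one_iff₀ (norm_nonneg _), ← real_inner_self_eq_norm_sq, Set.mem_ofPred_eq, ← hBB,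
      ← mulVec_mulVec, dotProduct_mulVec, ← mulVec_transpose, hBT]
    rfl
  have hpos : 0 < |LinearMap.det (toEuclideanLin B)| := hdet ▸ Real.sqrt_pos.2 hA.det_pos
  rw [hset, measure_preimage_add_right, Measure.addHaar_preimage_linearMap _ (abs_pos.1 hpos),
    abs_inv, hdet]

theorem bhDensity_eq_sqrt_det {n : ℕ} {F : Coord n → Coord n → ℝ} {x w : Coord n}
    {A : Matrix (Fin n) (Fin n) ℝ} (hA : A.PosDef)
    (hF : ∀ y, F x y < 1 ↔ (y - w).ofLp ⬝ᵥ A *ᵥ (y - w).ofLp < 1) :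
    bhDensity F x = √A.det := by
  have hball : (volume (Metric.ball (0 : Coord n) 1)).toReal ≠ 0 :=
    (ENNReal.toReal_pos (Metric.measure_ball_pos _ _ one_pos).ne' measure_ball_lt_top.ne).ne'
  simp only [bhDensity, hF]
  rw [volume_setOf_dotProduct_mulVec_lt_one hA,
    ENNReal.toReal_mul, ENNReal.toReal_ofReal (by positivity), ← div_div, div_right_comm,
    div_self hball, one_div, inv_inv]

end BusemannHausdorff

section RandersVolume

variable {ε : ℝ} {p x y : Coord 2}

/-- The Gram matrix of the Klein metric. -/
def kleinMatrix (p : Coord 2) : Matrix (Fin 2) (Fin 2) ℝ :=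
  Matrix.of fun i j => klein p (e i) (e j)

theorem dotProduct_kleinMatrix_mulVec (p y : Coord 2) :
    dotProduct y.ofLp ((kleinMatrix p).mulVec y.ofLp) = klein p y y := by
  simp only [dotProduct, Matrix.mulVec, kleinMatrix, klein, Fin.sum_univ_two, Matrix.of_apply,
    e_apply, Fin.isValue, if_true, zero_ne_one, one_ne_zero, if_false]
  ring

theorem det_kleinMatrix (hp : 0 < kleinDen p) : (kleinMatrix p).det = (kleinDen p ^ 3)⁻¹ := by
  have hq : kleinDen p = 1 - (p 0 ^ 2 + p 1 ^ 2) := by rw [kleinDen, norm_sq_eq]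
  simp only [Matrix.det_fin_two, kleinMatrix, klein, Matrix.of_apply, e_apply, Fin.isValue,
    if_true, zero_ne_one, one_ne_zero, if_false, ← hq]
  field_simp
  rw [hq]
  ring

theorem posDef_kleinMatrix (hp : 0 < kleinDen p) : (kleinMatrix p).PosDef := by
  refine Matrix.PosDef.of_dotProduct_mulVec_pos ?_ fun v hv => ?_
  · ext i j
    simp only [kleinMatrix, Matrix.conjTranspose_apply, Matrix.of_apply, star_trivial, klein_eq,
      kleinForm_comm p (e i)]
  · rw [star_trivial, dotProduct_kleinMatrix_mulVec p (WithLp.toLp 2 v), klein_eq]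
    exact div_pos (kleinForm_pos hp (by simpa using hv)) (by positivity)

theorem randers_lt_one_iff (hp : p ∈ disk ε) :
    randers ε p y < 1 ↔ klein p (y - ε • rot p) (y - ε • rot p) < 1 := by
  have hq := kleinDen_pos hp
  have hK := kleinForm_sub_smul_rot ε p y 1
  rw [mul_one] at hK
  have hroot : 0 ≤ randersRoot ε p y := randersRoot_eq_sqrt hp y ▸ Real.sqrt_nonneg _
  rw [lt_iff_lt_quadratic (randersDen_pos hp) (randers_quadratic hp y) hroot
    (div_nonneg (kleinForm_nonneg hq y) hq.le) one_pos, klein_eq, hK, div_lt_one (by positivity),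
    div_lt_iff₀ hq]
  constructor <;> intro h <;> linarith

theorem bhDensity_randers (hp : p ∈ disk ε) :
    bhDensity (randers ε) p = kleinDen p ^ (-3 / 2 : ℝ) := by
  have hq := kleinDen_pos hp
  rw [bhDensity_eq_sqrt_det (posDef_kleinMatrix hq) fun y => by
    rw [dotProduct_kleinMatrix_mulVec, randers_lt_one_iff hp], det_kleinMatrix hq,
    Real.sqrt_eq_rpow, ← Real.rpow_natCast, ← Real.rpow_neg hq.le, ← Real.rpow_mul hq.le]
  norm_num

theorem pd_bhDensity_randers (hx : x ∈ disk ε) (i : Fin 2) :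
    pd (bhDensity (randers ε)) i x = 3 * x i / kleinDen x * bhDensity (randers ε) x := by
  have hq := (kleinDen_pos hx).ne'
  have hden : HasDirDerivAt kleinDen (-2 * x i) x (e i) := by
    rw [← inner_e_right x i]
    exact HasDirDerivAt.left (F := fun x _ => kleinDen x) (hasDirDerivAt_kleinDen (x, 0) (e i, 0))
  have hσ := (hden.scomp (Real.hasDerivAt_rpow_const (p := -3 / 2) (.inl hq))).congr_of_eventuallyEq
    (g := bhDensity (randers ε)) <|
    eventuallyEq_of_mem ((isOpen_disk ε).mem_nhds hx) fun _ hx' => bhDensity_randers hx'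
  rw [pd, hσ.fderiv_apply, Real.rpow_sub_one hq, ← bhDensity_randers hx]
  ring

theorem sum_dY_randersSpray (h : (x, y) ∈ slit (disk ε)) :
    ∑ i, dY (randersSpray ε i) i x y = 3 * kleinFactor x y := by
  have hrot : ∑ i, dY (randers ε) i x y * rot (airCovector ε x y) i = 0 := by
    refine (mul_eq_zero.1 ?_).resolve_left (randersRoot_pos h.1 h.2).ne'
    simp only [Finset.mul_sum, ← mul_assoc, randersRoot_mul_dY h]
    rw [← inner_rot_self (airCovector ε x y), real_inner_eq, Fin.sum_univ_two]
  have hxu : ⟪x, airVelocity ε x y⟫ = kleinDen x * kleinFactor x y := by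
    rw [inner_airVelocity, kleinDen_mul_kleinFactor h.1]
  have hq := (kleinDen_pos h.1).ne'
  rw [real_inner_eq] at hxu
  simp only [Fin.sum_univ_two, dY_randersSpray h, rot_apply_zero (e 0), rot_apply_one (e 1),
    e_apply, Fin.isValue, if_true, zero_ne_one, one_ne_zero, if_false] at hrot ⊢
  linear_combination (norm := (field_simp; ring)) hxu / kleinDen x - ε * hrot

theorem sCurv_randers (h : (x, y) ∈ slit (disk ε)) : sCurv (randers ε) x y = 0 := by
  have hσ : bhDensity (randers ε) x ≠ 0 :=
    bhDensity_randers h.1 ▸ (Real.rpow_pos_of_pos (kleinDen_pos h.1) _).ne'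
  have htrace : ∑ i, pd (fun w => spray (randers ε) x w i) i y = 3 * kleinFactor x y :=
    (Finset.sum_congr rfl fun i _ => (isSprayOn_randersSpray ε).dY_spray_eq
      (isFinslerOn_randers ε) (isOpen_disk ε) h i i).trans (sum_dY_randersSpray h)
  rw [sCurv, htrace, kleinFactor, real_inner_eq, Fin.sum_univ_two, pd_bhDensity_randers h.1,
    pd_bhDensity_randers h.1]
  field_simp
  ring

end RandersVolume

section NormedSpace

variable {E E' : Type*} [NormedAddCommGroup E] [NormedSpace ℝ E] [NormedAddCommGroup E']
  [NormedSpace ℝ E']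

theorem map_eq_zero_of_frequently_eq {g : E → E'} {L : E →L[ℝ] E'} {p v : E} {ι : Type*}
    {l : Filter ι} {a b : ι → E} {r : ι → ℝ} (hg : HasStrictFDerivAt g L p)
    (ha : Tendsto a l (𝓝 p)) (hb : Tendsto b l (𝓝 p))
    (h : ∃ᶠ t in l, g (a t) = g (b t) ∧ r t ≠ 0 ∧ a t - b t = r t • v) : L v = 0 := by
  have hbound : ∀ c : ℝ, 0 < c → ‖L v‖ ≤ c * ‖v‖ := fun c hc => by
    have hlittle := (hg.isLittleO.comp_tendsto (ha.prodMk_nhds hb)).def hc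
    obtain ⟨t, ⟨heq, hr, hsub⟩, ht⟩ := (h.and_eventually hlittle).exists
    simp only [comp_apply, heq, hsub, sub_self, zero_sub, norm_neg, map_smul, norm_smul] at ht
    exact le_of_mul_le_mul_left (by linarith) (norm_pos_iff.2 hr)
  have hlim : Tendsto (fun c : ℝ => c * ‖v‖) (𝓝[>] 0) (𝓝 0) :=
    ((continuous_mul_const ‖v‖).tendsto' 0 0 (zero_mul _)).mono_left nhdsWithin_le_nhds
  exact norm_le_zero_iff.1 (ge_of_tendsto hlim (eventually_mem_nhdsWithin.mono hbound))

theorem sub_mem_span_of_collinear {c : ℝ → E} {w : E} {s : Set ℝ} {t₀ t : ℝ}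
    (hc : HasDerivAt c w t₀) (hw : w ≠ 0) (hs : s ∈ 𝓝 t₀) (hcol : Collinear ℝ (c '' s))
    (ht : t ∈ s) : c t - c t₀ ∈ Submodule.span ℝ {w} := by
  obtain ⟨v, hv⟩ := (collinear_iff_of_mem (Set.mem_image_of_mem c (mem_of_mem_nhds hs))).1 hcol
  have hmem : ∀ τ ∈ s, c τ - c t₀ ∈ Submodule.span ℝ {v} := fun τ hτ => by
    obtain ⟨r, hr⟩ := hv (c τ) (Set.mem_image_of_mem c hτ)
    rw [hr, vadd_eq_add, add_sub_cancel_right]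
    exact Submodule.smul_mem _ r (Submodule.mem_span_singleton_self v)
  have hwv : w ∈ Submodule.span ℝ {v} :=
    (Submodule.closed_of_finiteDimensional _).mem_of_tendsto hc.tendsto_slope <|
      (eventually_nhdsWithin_of_eventually_nhds hs).mono fun τ hτ =>
        Submodule.smul_mem _ _ (hmem τ hτ)
  obtain ⟨k, rfl⟩ := Submodule.mem_span_singleton.1 hwv
  rw [Submodule.span_singleton_smul_eq (IsUnit.mk0 k (left_ne_zero_of_smul hw))]
  exact hmem t ht

theorem fderiv_symm_comp_fderiv {φ : OpenPartialHomeomorph E E'} {p : E} (hp : p ∈ φ.source)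
    (hφ : DifferentiableAt ℝ φ p) (hφs : DifferentiableAt ℝ φ.symm (φ p)) :
    (fderiv ℝ φ.symm (φ p)).comp (fderiv ℝ φ p) = ContinuousLinearMap.id ℝ E :=
  (hφs.hasFDerivAt.comp p hφ.hasFDerivAt).unique <|
    (hasFDerivAt_id p).congr_of_eventuallyEq (φ.eventually_left_inverse hp)

end NormedSpace

section Tanh

theorem hasDerivAt_tanh (t : ℝ) : HasDerivAt Real.tanh (1 - Real.tanh t ^ 2) t := by
  have hc := (Real.cosh_pos t).ne'
  have h := (Real.hasDerivAt_sinh t).div (Real.hasDerivAt_cosh t) hc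
  rw [Real.tanh_eq_sinh_div_cosh, show Real.tanh = Real.sinh / Real.cosh from
    funext Real.tanh_eq_sinh_div_cosh]
  refine h.congr_deriv ?_
  field_simp

theorem contDiff_tanh : ContDiff ℝ ∞ Real.tanh := by
  rw [show Real.tanh = fun t => Real.sinh t / Real.cosh t from funext Real.tanh_eq_sinh_div_cosh]
  exact Real.contDiff_sinh.div Real.contDiff_cosh fun t => (Real.cosh_pos t).ne'

end Tanh

section Spiral

variable {ε : ℝ} {u : Coord 2}

/-- The rotation of the plane by the angle `θ`, the flow of the field `rot`. -/
def rotBy (θ : ℝ) (u : Coord 2) : Coord 2 := Real.cos θ • u + Real.sin θ • rot u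

theorem rot_rotBy (θ : ℝ) (u : Coord 2) : rot (rotBy θ u) = rotBy θ (rot u) := by
  rw [rotBy, rot_add, rot_smul, rot_smul, rotBy]

theorem norm_rotBy (θ : ℝ) (u : Coord 2) : ‖rotBy θ u‖ = ‖u‖ := by
  rw [← sq_eq_sq₀ (norm_nonneg _) (norm_nonneg _), ← real_inner_self_eq_norm_sq, rotBy]
  simp only [inner_add_left, inner_add_right, real_inner_smul_left, real_inner_smul_right,
    inner_rot_left, inner_rot_self, rot_rot, inner_neg_right]
  rw [← real_inner_self_eq_norm_sq]
  linear_combination ⟪u, u⟫ * Real.cos_sq_add_sin_sq θ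

theorem hasDerivAt_rotBy_mul (ε : ℝ) (u : Coord 2) (t : ℝ) :
    HasDerivAt (fun t => rotBy (ε * t) u) (ε • rot (rotBy (ε * t) u)) t := by
  have harg : HasDerivAt (fun t => ε * t) ε t := by
    simpa using (hasDerivAt_id t).const_mul ε
  refine ((harg.cos.smul_const u).add (harg.sin.smul_const (rot u))).congr_deriv ?_
  rw [rotBy, rot_add, rot_smul, rot_smul, rot_rot]
  module

/-- The curve `t ↦ R_{εt} (tanh t • u)`, where `t ↦ tanh t • u` is, for a unit vector `u`, a
unit-speed geodesic of the Klein metric. -/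
def spiral (ε : ℝ) (u : Coord 2) (t : ℝ) : Coord 2 := Real.tanh t • rotBy (ε * t) u

/-- The velocity of `spiral`. -/
def spiralVel (ε : ℝ) (u : Coord 2) (t : ℝ) : Coord 2 :=
  (1 - Real.tanh t ^ 2) • rotBy (ε * t) u + ε • rot (spiral ε u t)

theorem rot_spiral (ε : ℝ) (u : Coord 2) (t : ℝ) : rot (spiral ε u t) = spiral ε (rot u) t := by
  rw [spiral, rot_smul, rot_rotBy, spiral]

theorem spiral_zero (ε : ℝ) (u : Coord 2) : spiral ε u 0 = 0 := by
  rw [spiral, Real.tanh_zero, zero_smul]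

theorem spiralVel_zero (ε : ℝ) (u : Coord 2) : spiralVel ε u 0 = u := by
  simp [spiralVel, spiral_zero, rotBy]

theorem hasDerivAt_spiral (ε : ℝ) (u : Coord 2) (t : ℝ) :
    HasDerivAt (spiral ε u) (spiralVel ε u t) t := by
  refine ((hasDerivAt_tanh t).smul (hasDerivAt_rotBy_mul ε u t)).congr_deriv ?_
  rw [spiralVel, spiral, rot_smul]
  module

theorem hasDerivAt_spiralVel (ε : ℝ) (u : Coord 2) (t : ℝ) :
    HasDerivAt (spiralVel ε u) ((2 * ε) • rot (spiralVel ε u t)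
      + (ε ^ 2 - 2 * (1 - Real.tanh t ^ 2)) • spiral ε u t) t := by
  have hrot : HasDerivAt (fun t => rot (spiral ε u t)) (spiralVel ε (rot u) t) t := by
    simpa only [rot_spiral] using hasDerivAt_spiral ε (rot u) t
  refine (((((hasDerivAt_tanh t).pow 2).const_sub 1).smul (hasDerivAt_rotBy_mul ε u t)).add
    (hrot.const_smul ε)).congr_deriv ?_
  simp only [spiralVel, spiral, rot_add, rot_smul, rot_rot, ← rot_rotBy, Pi.pow_apply]
  module

theorem contDiff_spiral (ε : ℝ) (u : Coord 2) : ContDiff ℝ ∞ (spiral ε u) := by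
  have := contDiff_tanh
  unfold spiral rotBy
  fun_prop

theorem tendsto_spiral_zero (ε : ℝ) (u : Coord 2) : Tendsto (spiral ε u) (𝓝 0) (𝓝 0) :=
  (contDiff_spiral ε u).continuous.tendsto' 0 0 (spiral_zero ε u)

theorem spiral_sub_spiral_neg (ε : ℝ) (u : Coord 2) (t : ℝ) :
    spiral ε u t - spiral ε (-u) (-t) = (2 * Real.tanh t * Real.sin (ε * t)) • rot u := by
  rw [spiral, spiral, rotBy, rotBy, ← neg_one_smul ℝ u, rot_smul, mul_neg, Real.cos_neg,
    Real.sin_neg, Real.tanh_neg]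
  module

theorem one_sub_tanh_sq_pos (t : ℝ) : 0 < 1 - Real.tanh t ^ 2 :=
  sub_pos.2 (Real.tanh_sq_lt_one t)

variable (hu : ‖u‖ = 1)
include hu

theorem kleinDen_spiral (ε t : ℝ) : kleinDen (spiral ε u t) = 1 - Real.tanh t ^ 2 := by
  rw [kleinDen, spiral, norm_smul, norm_rotBy, hu, mul_one, Real.norm_eq_abs, sq_abs]

theorem inner_rotBy_spiralVel (ε t : ℝ) :
    ⟪rotBy (ε * t) u, spiralVel ε u t⟫ = 1 - Real.tanh t ^ 2 := by
  rw [spiralVel, spiral, rot_smul, inner_add_right]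
  simp only [real_inner_smul_right, inner_rot_self, real_inner_self_eq_norm_sq, norm_rotBy, hu]
  ring

theorem spiralVel_ne_zero (ε t : ℝ) : spiralVel ε u t ≠ 0 := fun h => by
  have hinner := inner_rotBy_spiralVel hu ε t
  rw [h, inner_zero_right] at hinner
  exact (one_sub_tanh_sq_pos t).ne hinner

theorem kleinFactor_spiral (ε t : ℝ) :
    kleinFactor (spiral ε u t) (spiralVel ε u t) = Real.tanh t := by
  rw [kleinFactor, kleinDen_spiral hu, div_eq_iff (one_sub_tanh_sq_pos t).ne', spiral,
    real_inner_smul_left, inner_rotBy_spiralVel hu]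

theorem randers_spiralVel {t : ℝ} (h : spiral ε u t ∈ disk ε) :
    randers ε (spiral ε u t) (spiralVel ε u t) = 1 := by
  rw [eq_comm, ← kleinNorm_eq_one_iff_eq_randers h (spiralVel_ne_zero hu ε t) one_pos,
    kleinNorm_eq_one_iff (kleinDen_pos h), inv_one, one_smul, spiralVel, add_sub_cancel_right,
    kleinForm_smul_self, kleinForm, kleinDen_spiral hu, spiral, real_inner_smul_left,
    real_inner_self_eq_norm_sq, norm_rotBy, hu]
  ring

theorem isGeodesicIn_spiral {V : Set (Coord 2)} (hV : V ⊆ disk ε) {s t : ℝ}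
    (h : ∀ τ ∈ Set.Ioo s t, spiral ε u τ ∈ V) : IsGeodesicIn (randers ε) V s t (spiral ε u) := by
  have hderiv : deriv (spiral ε u) = spiralVel ε u :=
    funext fun τ => (hasDerivAt_spiral ε u τ).deriv
  have hsmooth : ContDiff ℝ 2 (spiral ε u) :=
    (contDiff_spiral ε u).of_le (WithTop.coe_le_coe.2 le_top)
  refine ⟨hsmooth.contDiffOn, h, fun τ _ => ?_, fun τ hτ i => ?_⟩ <;> rw [hderiv]
  · exact spiralVel_ne_zero hu ε τ
  · rw [(hasDerivAt_spiralVel ε u τ).deriv, (isSprayOn_randersSpray ε).spray_eq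
      (isFinslerOn_randers ε) (isOpen_disk ε) (x := spiral ε u τ) (y := spiralVel ε u τ)
      ⟨hV (h τ hτ), spiralVel_ne_zero hu ε τ⟩,
      randersSpray, kleinFactor_spiral hu, airVelocity, randers_spiralVel hu (hV (h τ hτ))]
    simp only [spiralVel, spiral, rot_add, rot_smul, rot_rot, PiLp.add_apply, PiLp.sub_apply,
      PiLp.smul_apply, PiLp.neg_apply, smul_eq_mul]
    ring

theorem eventually_chart_spiral_sub_mem_span {φ : OpenPartialHomeomorph (Coord 2) (Coord 2)}
    (h0 : (0 : Coord 2) ∈ φ.source) (hsub : φ.source ⊆ disk ε) (hφ : DifferentiableAt ℝ φ 0)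
    (hne : fderiv ℝ φ 0 u ≠ 0)
    (hgeo : ∀ (s t : ℝ) (c : ℝ → Coord 2), IsGeodesicIn (randers ε) φ.source s t c →
      Collinear ℝ ((fun τ => φ (c τ)) '' Set.Ioo s t)) :
    ∀ᶠ t in 𝓝 0, φ (spiral ε u t) - φ 0 ∈ Submodule.span ℝ {fderiv ℝ φ 0 u} := by
  have hsource : ∀ᶠ t in 𝓝 (0 : ℝ), spiral ε u t ∈ φ.source :=
    (tendsto_spiral_zero ε u).eventually (φ.open_source.mem_nhds h0)
  obtain ⟨δ, hδ, hball⟩ := Metric.eventually_nhds_iff_ball.1 hsource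
  have hmem := Metric.ball_mem_nhds (0 : ℝ) hδ
  rw [Real.ball_eq_Ioo] at hball hmem
  have hderiv : HasDerivAt (fun t => φ (spiral ε u t)) (fderiv ℝ φ 0 u) 0 := by
    have hspiral := hasDerivAt_spiral ε u 0
    rw [spiralVel_zero] at hspiral
    exact hφ.hasFDerivAt.comp_hasDerivAt_of_eq (0 : ℝ) hspiral (spiral_zero ε u).symm
  filter_upwards [hmem] with t ht
  simpa only [spiral_zero] using
    sub_mem_span_of_collinear hderiv hne hmem (hgeo _ _ _ (isGeodesicIn_spiral hu hsub hball)) ht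

theorem eventually_clm_chart_spiral_eq {φ : OpenPartialHomeomorph (Coord 2) (Coord 2)}
    {ℓ : Coord 2 →L[ℝ] ℝ} (h0 : (0 : Coord 2) ∈ φ.source) (hsub : φ.source ⊆ disk ε)
    (hφ : DifferentiableAt ℝ φ 0) (hne : fderiv ℝ φ 0 u ≠ 0) (hℓ : ℓ (fderiv ℝ φ 0 u) = 0)
    (hgeo : ∀ (s t : ℝ) (c : ℝ → Coord 2), IsGeodesicIn (randers ε) φ.source s t c →
      Collinear ℝ ((fun τ => φ (c τ)) '' Set.Ioo s t)) :
    ∀ᶠ t in 𝓝 0, ℓ (φ (spiral ε u t)) = ℓ (φ 0) := by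
  filter_upwards [eventually_chart_spiral_sub_mem_span hu h0 hsub hφ hne hgeo] with t ht
  obtain ⟨k, hk⟩ := Submodule.mem_span_singleton.1 ht
  rw [← sub_eq_zero, ← map_sub, ← hk, map_smul, hℓ, smul_zero]

end Spiral

section ProjectivelyFlat

variable {ε : ℝ}

theorem norm_e {n : ℕ} (i : Fin n) : ‖(e i : Coord n)‖ = 1 := by simp [e]

theorem eventually_tanh_mul_sin_ne_zero (hε : ε ≠ 0) :
    ∀ᶠ t in 𝓝[≠] (0 : ℝ), 2 * Real.tanh t * Real.sin (ε * t) ≠ 0 := by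
  have htanh : HasDerivAt Real.tanh 1 0 := by simpa using hasDerivAt_tanh 0
  have hsin : HasDerivAt (fun t => Real.sin (ε * t)) ε 0 := by
    simpa using ((hasDerivAt_id (0 : ℝ)).const_mul ε).sin
  filter_upwards [htanh.eventually_ne one_ne_zero, hsin.eventually_ne hε] with t ht ht'
  exact mul_ne_zero (mul_ne_zero two_ne_zero ht) ht'

theorem not_isLocallyProjectivelyFlatOn_randers (hε : ε ≠ 0) :
    ¬ IsLocallyProjectivelyFlatOn (disk ε) (randers ε) := by
  intro hflat
  obtain ⟨φ, h0, hsub, hφ, hφs, hgeo⟩ := hflat 0 (zero_mem_disk ε)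
  have hstrict : HasStrictFDerivAt φ (fderiv ℝ φ 0) 0 :=
    (hφ.contDiffAt (φ.open_source.mem_nhds h0)).hasStrictFDerivAt (by simp)
  have hdiff := hstrict.hasFDerivAt.differentiableAt
  have hinv (v : Coord 2) : fderiv ℝ φ.symm (φ 0) (fderiv ℝ φ 0 v) = v :=
    DFunLike.congr_fun (fderiv_symm_comp_fderiv h0 hdiff <|
      (hφs.contDiffAt (φ.open_target.mem_nhds (φ.map_source h0))).differentiableAt (by simp)) v
  let ℓ : Coord 2 →L[ℝ] ℝ := (EuclideanSpace.proj 1).comp (fderiv ℝ φ.symm (φ 0))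
  have hℓ (v : Coord 2) : ℓ (fderiv ℝ φ 0 v) = v 1 := congrArg (· 1) (hinv v)
  have hline (u : Coord 2) (hu : ‖u‖ = 1) (hu' : u 1 = 0) :
      ∀ᶠ t in 𝓝 0, ℓ (φ (spiral ε u t)) = ℓ (φ 0) := by
    have hne : fderiv ℝ φ 0 u ≠ 0 := fun h => by
      have hu0 := hinv u
      rw [h, map_zero] at hu0
      simp [← hu0] at hu
    exact eventually_clm_chart_spiral_eq hu h0 hsub hdiff hne ((hℓ u).trans hu') hgeo
  have hneg : Tendsto (fun t : ℝ => -t) (𝓝 0) (𝓝 0) := continuous_neg.tendsto' 0 0 neg_zero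
  have hev : ∀ᶠ t in 𝓝[≠] (0 : ℝ),
      ℓ (φ (spiral ε (e 0) t)) = ℓ (φ (spiral ε (-e 0) (-t))) ∧
        2 * Real.tanh t * Real.sin (ε * t) ≠ 0 ∧ spiral ε (e 0) t - spiral ε (-e 0) (-t) =
          (2 * Real.tanh t * Real.sin (ε * t)) • rot (e 0) := by
    filter_upwards [eventually_tanh_mul_sin_ne_zero hε,
      nhdsWithin_le_nhds (hline (e 0) (norm_e 0) (by simp)),
      nhdsWithin_le_nhds (hneg.eventually (hline (-e 0) (by rw [norm_neg, norm_e]) (by simp)))]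
      with t ht hpos hneg
    exact ⟨hpos.trans hneg.symm, ht, spiral_sub_spiral_neg ε (e 0) t⟩
  have hzero := map_eq_zero_of_frequently_eq (ℓ.hasStrictFDerivAt.comp 0 hstrict)
    ((tendsto_spiral_zero ε (e 0)).mono_left nhdsWithin_le_nhds)
    (((tendsto_spiral_zero ε (-e 0)).comp hneg).mono_left nhdsWithin_le_nhds) hev.frequently
  rw [ContinuousLinearMap.comp_apply, hℓ, rot_apply_one, e_apply, if_pos rfl] at hzero
  exact one_ne_zero hzero

end ProjectivelyFlat

section RadialMetric

variable {x : Coord n} {a b P Q R : ℝ → ℝ}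

theorem hasDirDerivAt_comp_norm_sq {f : ℝ → ℝ} {f' : ℝ} (hf : HasDerivAt f f' (‖x‖ ^ 2))
    (k : Fin n) : HasDirDerivAt (fun x => f (‖x‖ ^ 2)) (f' * (2 * x k)) x (e k) := by
  have hnorm := HasDirDerivAt.of_hasFDerivAt (hasStrictFDerivAt_norm_sq x).hasFDerivAt (e k)
  refine (HasDirDerivAt.scomp (f := fun x => ‖x‖ ^ 2) hf hnorm).congr_deriv ?_
  rw [← inner_e_right x k, smul_apply, innerSL_apply_apply, nsmul_eq_mul,
    Nat.cast_ofNat]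

/-- The rotationally symmetric metric with coefficients `a(|x|²) δ_ij + b(|x|²) x_i x_j`. -/
def radialCoeff (a b : ℝ → ℝ) (x : Coord n) : Matrix (Fin n) (Fin n) ℝ :=
  Matrix.of fun i j => a (‖x‖ ^ 2) * (if i = j then 1 else 0) + b (‖x‖ ^ 2) * (x i * x j)

/-- The general form
`P(|x|²) (x_i δ_jk + x_j δ_ik) + Q(|x|²) δ_ij x_k + R(|x|²) x_i x_j x_k`
of the Christoffel symbols `Γ^k_{ij}` of a rotationally symmetric metric. -/
def radialSymbol (P Q R : ℝ → ℝ) (k i j : Fin n) (x : Coord n) : ℝ :=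
  P (‖x‖ ^ 2) * (x i * (if j = k then 1 else 0) + x j * (if i = k then 1 else 0))
    + Q (‖x‖ ^ 2) * ((if i = j then 1 else 0) * x k) + R (‖x‖ ^ 2) * (x i * x j * x k)

theorem pd_radialCoeff {a' b' : ℝ} (ha : HasDerivAt a a' (‖x‖ ^ 2))
    (hb : HasDerivAt b b' (‖x‖ ^ 2)) (i j k : Fin n) :
    pd (fun x => radialCoeff a b x i j) k x =
      2 * x k * (a' * (if i = j then 1 else 0) + b' * (x i * x j))
        + b (‖x‖ ^ 2) * ((if i = k then 1 else 0) * x j + x i * (if j = k then 1 else 0)) := by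
  have hx (i : Fin n) := hasDirDerivAt_coord i x (e k)
  have h := ((hasDirDerivAt_comp_norm_sq ha k).mul (.const (if i = j then 1 else 0))).add
    ((hasDirDerivAt_comp_norm_sq hb k).mul ((hx i).mul (hx j)))
  refine h.fderiv_apply.trans ?_
  simp only [e_apply]
  ring

theorem radialCoeff_mulVec_radialSymbol (i j k : Fin n) :
    (radialCoeff a b x).mulVec (fun l => radialSymbol P Q R l i j x) k =
      a (‖x‖ ^ 2) * radialSymbol P Q R k i j x
        + b (‖x‖ ^ 2) * x k * (2 * P (‖x‖ ^ 2) * (x i * x j)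
          + ‖x‖ ^ 2 * (Q (‖x‖ ^ 2) * (if i = j then 1 else 0) + R (‖x‖ ^ 2) * (x i * x j))) := by
  have hinner : ∑ l, x l * radialSymbol P Q R l i j x = 2 * P (‖x‖ ^ 2) * (x i * x j)
      + ‖x‖ ^ 2 * (Q (‖x‖ ^ 2) * (if i = j then 1 else 0) + R (‖x‖ ^ 2) * (x i * x j)) := by
    have hsum : ∑ l, x l * radialSymbol P Q R l i j x =
        P (‖x‖ ^ 2) * (x i * ∑ l, x l * (if j = l then 1 else 0)
            + x j * ∑ l, x l * (if i = l then 1 else 0))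
          + (∑ l, x l ^ 2) *
            (Q (‖x‖ ^ 2) * (if i = j then 1 else 0) + R (‖x‖ ^ 2) * (x i * x j)) := by
      simp only [Finset.mul_sum, Finset.sum_mul, ← Finset.sum_add_distrib, radialSymbol]
      exact Finset.sum_congr rfl fun l _ => by ring
    simp only [hsum, ← EuclideanSpace.real_norm_sq_eq, mul_ite, mul_one, mul_zero,
      Finset.sum_ite_eq, Finset.mem_univ, if_true]
    ring
  rw [← hinner, Finset.mul_sum]
  simp only [Matrix.mulVec, dotProduct, radialCoeff, Matrix.of_apply, add_mul,
    Finset.sum_add_distrib, mul_ite, ite_mul, mul_one, mul_zero, zero_mul, Finset.sum_ite_eq,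
    Finset.mem_univ, if_true]
  exact congrArg _ (Finset.sum_congr rfl fun l _ => by ring)

theorem christoffel_congr {g h : Coord n → Matrix (Fin n) (Fin n) ℝ} (hgh : g =ᶠ[𝓝 x] h)
    (k i j : Fin n) : christoffel g k i j x = christoffel h k i j x := by
  have hpd (i j k : Fin n) : pd (fun x => g x i j) k x = pd (fun x => h x i j) k x :=
    DFunLike.congr_fun (EventuallyEq.fderiv_eq (hgh.mono fun x' hx' => by rw [hx'])) _
  simp only [christoffel, hpd, hgh.eq_of_nhds]

theorem christoffel_radialCoeff (hdet : IsUnit (radialCoeff a b x).det)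
    (ha : HasDerivAt a (a (‖x‖ ^ 2) * P (‖x‖ ^ 2)) (‖x‖ ^ 2))
    (hb : HasDerivAt b (2 * b (‖x‖ ^ 2) * P (‖x‖ ^ 2)
      + (a (‖x‖ ^ 2) + ‖x‖ ^ 2 * b (‖x‖ ^ 2)) * R (‖x‖ ^ 2)) (‖x‖ ^ 2))
    (hQ : (a (‖x‖ ^ 2) + ‖x‖ ^ 2 * b (‖x‖ ^ 2)) * Q (‖x‖ ^ 2) =
      b (‖x‖ ^ 2) - a (‖x‖ ^ 2) * P (‖x‖ ^ 2)) (k i j : Fin n) :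
    christoffel (radialCoeff a b) k i j x = radialSymbol P Q R k i j x := by
  have hlower (l : Fin n) :
      pd (fun x => radialCoeff a b x j l) i x + pd (fun x => radialCoeff a b x i l) j x
          - pd (fun x => radialCoeff a b x i j) l x =
        2 * (radialCoeff a b x).mulVec (fun l => radialSymbol P Q R l i j x) l := by
    rw [radialCoeff_mulVec_radialSymbol]
    simp only [pd_radialCoeff ha hb, radialSymbol, eq_comm (a := l), eq_comm (a := j) (b := i)]
    linear_combination -2 * (if i = j then 1 else 0) * x l * hQ
  have hraise : (radialCoeff a b x)⁻¹.mulVec ((radialCoeff a b x).mulVec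
      fun l => radialSymbol P Q R l i j x) k = radialSymbol P Q R k i j x := by
    rw [Matrix.mulVec_mulVec, Matrix.nonsing_inv_mul _ hdet, Matrix.one_mulVec]
  rw [← hraise, christoffel]
  simp only [hlower, Matrix.mulVec, dotProduct, mul_left_comm _ (2 : ℝ), ← Finset.mul_sum]
  ring

theorem pd_radialSymbol {P' Q' : ℝ} (hP : HasDerivAt P P' (‖x‖ ^ 2))
    (hQ : HasDerivAt Q Q' (‖x‖ ^ 2)) (hR : DifferentiableAt ℝ R (‖x‖ ^ 2)) (k i j l : Fin n) :
    pd (radialSymbol P Q R k i j) l x =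
      2 * x l * (P' * (x i * (if j = k then 1 else 0) + x j * (if i = k then 1 else 0))
          + Q' * ((if i = j then 1 else 0) * x k) + deriv R (‖x‖ ^ 2) * (x i * x j * x k))
        + P (‖x‖ ^ 2) * ((if i = l then 1 else 0) * (if j = k then 1 else 0)
            + (if j = l then 1 else 0) * (if i = k then 1 else 0))
        + Q (‖x‖ ^ 2) * ((if i = j then 1 else 0) * (if k = l then 1 else 0))
        + R (‖x‖ ^ 2) * ((if i = l then 1 else 0) * x j * x k
            + x i * (if j = l then 1 else 0) * x k + x i * x j * (if k = l then 1 else 0)) := by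
  have hx (i : Fin n) := hasDirDerivAt_coord i x (e l)
  have h := (((hasDirDerivAt_comp_norm_sq hP l).mul
    (((hx i).mul (.const (if j = k then 1 else 0))).add
      ((hx j).mul (.const (if i = k then 1 else 0))))).add
    ((hasDirDerivAt_comp_norm_sq hQ l).mul ((hx k).const_mul (if i = j then 1 else 0)))).add
    ((hasDirDerivAt_comp_norm_sq hR.hasDerivAt l).mul (((hx i).mul (hx j)).mul (hx k)))
  refine h.fderiv_apply.trans ?_
  simp only [e_apply]
  ring

end RadialMetric

section RadialSurface

variable {x : Coord 2} {g : Coord 2 → Matrix (Fin 2) (Fin 2) ℝ} {P Q R : ℝ → ℝ} {P' Q' : ℝ}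

theorem curvTensor_of_christoffel_eq_radialSymbol
    (hg : ∀ k i j, christoffel g k i j =ᶠ[𝓝 x] radialSymbol P Q R k i j)
    (hP : HasDerivAt P P' (‖x‖ ^ 2)) (hQ : HasDerivAt Q Q' (‖x‖ ^ 2))
    (hR : DifferentiableAt ℝ R (‖x‖ ^ 2)) (l : Fin 2) :
    curvTensor g l 1 0 1 x =
      (Q (‖x‖ ^ 2) - P (‖x‖ ^ 2) + ‖x‖ ^ 2 * (2 * Q' - R (‖x‖ ^ 2)
          + Q (‖x‖ ^ 2) * (P (‖x‖ ^ 2) + Q (‖x‖ ^ 2) + ‖x‖ ^ 2 * R (‖x‖ ^ 2))))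
        * (if l = 0 then 1 else 0)
      - (2 * (R (‖x‖ ^ 2) - P' - Q') + (P (‖x‖ ^ 2) - Q (‖x‖ ^ 2))
          * (P (‖x‖ ^ 2) + Q (‖x‖ ^ 2) + ‖x‖ ^ 2 * R (‖x‖ ^ 2))) * (x 1 * rot x l) := by
  have hpd (k i j m : Fin 2) :
      pd (christoffel g k i j) m x = pd (radialSymbol P Q R k i j) m x :=
    DFunLike.congr_fun (hg k i j).fderiv_eq (e m)
  simp only [curvTensor, hpd, pd_radialSymbol hP hQ hR, (hg _ _ _).eq_of_nhds, radialSymbol,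
    Fin.sum_univ_two, norm_sq_eq]
  fin_cases l <;>
    simp only [rot_apply_zero, rot_apply_one, Fin.zero_eta, Fin.mk_one, Fin.isValue, if_true,
      zero_ne_one, one_ne_zero, if_false] <;>
    ring

theorem gaussCurv_of_christoffel_eq_radialSymbol {a b : ℝ → ℝ} {K : ℝ}
    (hgx : g x = radialCoeff a b x) (hdet : IsUnit (g x).det)
    (hg : ∀ k i j, christoffel g k i j =ᶠ[𝓝 x] radialSymbol P Q R k i j)
    (hP : HasDerivAt P P' (‖x‖ ^ 2)) (hQ : HasDerivAt Q Q' (‖x‖ ^ 2))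
    (hR : DifferentiableAt ℝ R (‖x‖ ^ 2))
    (ha : Q (‖x‖ ^ 2) - P (‖x‖ ^ 2) + ‖x‖ ^ 2 * (2 * Q' - R (‖x‖ ^ 2)
      + Q (‖x‖ ^ 2) * (P (‖x‖ ^ 2) + Q (‖x‖ ^ 2) + ‖x‖ ^ 2 * R (‖x‖ ^ 2))) = K * a (‖x‖ ^ 2))
    (hb : 2 * (R (‖x‖ ^ 2) - P' - Q') + (P (‖x‖ ^ 2) - Q (‖x‖ ^ 2))
      * (P (‖x‖ ^ 2) + Q (‖x‖ ^ 2) + ‖x‖ ^ 2 * R (‖x‖ ^ 2)) = K * b (‖x‖ ^ 2)) :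
    gaussCurv g x = K := by
  rw [gaussCurv, div_eq_iff hdet.ne_zero]
  simp only [curvTensor_of_christoffel_eq_radialSymbol hg hP hQ hR, ha, hb, hgx, radialCoeff,
    Fin.sum_univ_two, Matrix.det_fin_two, Matrix.of_apply, rot_apply_zero, rot_apply_one,
    Fin.isValue, if_true, zero_ne_one, one_ne_zero, if_false]
  ring

end RadialSurface

section AlphaCurvature

variable {ε s : ℝ} {x : Coord 2}

/-- The coefficient of `δ_ij` in the radial metric `alphaCoeff ε`, as a function of `s = |x|²`. -/
def alphaIso (ε s : ℝ) : ℝ := (1 - s) / (1 - (1 + ε ^ 2) * s) ^ 2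

/-- The coefficient of `x_i x_j` in the radial metric `alphaCoeff ε`, as a function of
`s = |x|²`. -/
def alphaRad (ε s : ℝ) : ℝ := (1 - s - ε ^ 2) / ((1 - s) * (1 - (1 + ε ^ 2) * s) ^ 2)

/-- The function `P` in the `radialSymbol` of `alphaCoeff ε`: the logarithmic derivative of
`alphaIso ε`. -/
def alphaSymbolP (ε s : ℝ) : ℝ := 2 * (1 + ε ^ 2) / (1 - (1 + ε ^ 2) * s) - 1 / (1 - s)

/-- The function `Q` in the `radialSymbol` of `alphaCoeff ε`. -/
def alphaSymbolQ (ε s : ℝ) : ℝ :=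
  -(ε ^ 2 * (2 * (1 - s) / (1 - (1 + ε ^ 2) * s) ^ 2 + 1 / (1 - (1 + ε ^ 2) * s)))

/-- The function `R` in the `radialSymbol` of `alphaCoeff ε`. -/
def alphaSymbolR (ε s : ℝ) : ℝ :=
  -(ε ^ 2 * (1 - (1 + ε ^ 2) * s + 2 * (1 - s) - 2 * ε ^ 2)) /
    ((1 - s) * (1 - (1 + ε ^ 2) * s) ^ 2)

theorem hasDerivAt_one_sub_mul (c s : ℝ) : HasDerivAt (fun s => 1 - c * s) (-c) s := by
  simpa using ((hasDerivAt_id s).const_mul c).const_sub 1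

theorem hasDerivAt_one_sub (s : ℝ) : HasDerivAt (fun s : ℝ => 1 - s) (-1) s :=
  (hasDerivAt_id s).const_sub 1

theorem hasDerivAt_alphaIso (hq : 1 - s ≠ 0) (hD : 1 - (1 + ε ^ 2) * s ≠ 0) :
    HasDerivAt (alphaIso ε) (alphaIso ε s * alphaSymbolP ε s) s := by
  refine ((hasDerivAt_one_sub s).fun_div ((hasDerivAt_one_sub_mul (1 + ε ^ 2) s).fun_pow 2)
    (pow_ne_zero 2 hD)).congr_deriv ?_
  rw [alphaIso, alphaSymbolP]
  field_simp
  ring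

theorem hasDerivAt_alphaRad (hq : 1 - s ≠ 0) (hD : 1 - (1 + ε ^ 2) * s ≠ 0) :
    HasDerivAt (alphaRad ε) (2 * alphaRad ε s * alphaSymbolP ε s
      + (alphaIso ε s + s * alphaRad ε s) * alphaSymbolR ε s) s := by
  refine (((hasDerivAt_one_sub s).sub_const (ε ^ 2)).fun_div ((hasDerivAt_one_sub s).fun_mul
    ((hasDerivAt_one_sub_mul (1 + ε ^ 2) s).fun_pow 2))
    (mul_ne_zero hq (pow_ne_zero 2 hD))).congr_deriv ?_
  rw [alphaIso, alphaRad, alphaSymbolP, alphaSymbolR]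
  have hD' := mul_comm (1 + ε ^ 2) _ ▸ hD
  field_simp
  ring

theorem alphaIso_add_mul_alphaSymbolQ (hq : 1 - s ≠ 0) (hD : 1 - (1 + ε ^ 2) * s ≠ 0) :
    (alphaIso ε s + s * alphaRad ε s) * alphaSymbolQ ε s =
      alphaRad ε s - alphaIso ε s * alphaSymbolP ε s := by
  rw [alphaIso, alphaRad, alphaSymbolP, alphaSymbolQ]
  have hD' := mul_comm (1 + ε ^ 2) _ ▸ hD
  field_simp
  ring

theorem hasDerivAt_alphaSymbolP (hq : 1 - s ≠ 0) (hD : 1 - (1 + ε ^ 2) * s ≠ 0) :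
    HasDerivAt (alphaSymbolP ε)
      (2 * (1 + ε ^ 2) ^ 2 / (1 - (1 + ε ^ 2) * s) ^ 2 - 1 / (1 - s) ^ 2) s := by
  refine (((hasDerivAt_const s (2 * (1 + ε ^ 2))).fun_div
    (hasDerivAt_one_sub_mul (1 + ε ^ 2) s) hD).sub
    ((hasDerivAt_const s 1).fun_div (hasDerivAt_one_sub s) hq)).congr_deriv ?_
  ring

theorem hasDerivAt_alphaSymbolQ (hD : 1 - (1 + ε ^ 2) * s ≠ 0) :
    HasDerivAt (alphaSymbolQ ε) (-(ε ^ 2 * ((ε ^ 2 - 1) / (1 - (1 + ε ^ 2) * s) ^ 2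
      + 4 * (1 + ε ^ 2) * (1 - s) / (1 - (1 + ε ^ 2) * s) ^ 3))) s := by
  have hden := hasDerivAt_one_sub_mul (1 + ε ^ 2) s
  refine (((((hasDerivAt_one_sub s).const_mul 2).fun_div (hden.fun_pow 2)
    (pow_ne_zero 2 hD)).add ((hasDerivAt_const s 1).fun_div hden hD)).const_mul
    (ε ^ 2)).neg.congr_deriv ?_
  field_simp
  ring

theorem differentiableAt_alphaSymbolR (hq : 1 - s ≠ 0) (hD : 1 - (1 + ε ^ 2) * s ≠ 0) :
    DifferentiableAt ℝ (alphaSymbolR ε) s := by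
  unfold alphaSymbolR
  fun_prop (disch := simp [hq, hD])

theorem alphaCoeff_eq_radialCoeff (hx : x ∈ disk ε) :
    alphaCoeff ε x = radialCoeff (alphaIso ε) (alphaRad ε) x :=
  Matrix.ext (alphaCoeff_eq hx)

theorem one_sub_norm_sq_ne_zero (hx : x ∈ disk ε) : 1 - ‖x‖ ^ 2 ≠ 0 := (kleinDen_pos hx).ne'

theorem one_sub_mul_norm_sq_ne_zero (hx : x ∈ disk ε) : 1 - (1 + ε ^ 2) * ‖x‖ ^ 2 ≠ 0 :=
  (randersDen_pos hx).ne'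

theorem isUnit_det_alphaCoeff (hx : x ∈ disk ε) : IsUnit (alphaCoeff ε x).det :=
  (posDef_alphaCoeff hx).det_pos.ne'.isUnit

theorem christoffel_alphaCoeff (hx : x ∈ disk ε) (k i j : Fin 2) :
    christoffel (alphaCoeff ε) k i j x =
      radialSymbol (alphaSymbolP ε) (alphaSymbolQ ε) (alphaSymbolR ε) k i j x := by
  have hq := one_sub_norm_sq_ne_zero hx
  have hD := one_sub_mul_norm_sq_ne_zero hx
  have hdet := isUnit_det_alphaCoeff hx
  rw [alphaCoeff_eq_radialCoeff hx] at hdet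
  rw [christoffel_congr (((isOpen_disk ε).eventually_mem hx).mono fun _ =>
    alphaCoeff_eq_radialCoeff)]
  exact christoffel_radialCoeff hdet (hasDerivAt_alphaIso hq hD) (hasDerivAt_alphaRad hq hD)
    (alphaIso_add_mul_alphaSymbolQ hq hD) k i j

theorem gaussCurv_alphaCoeff (hx : x ∈ disk ε) : gaussCurv (alphaCoeff ε) x =
    -(1 + 5 * ε ^ 2 + (1 + ε ^ 2) * (ε ^ 2 - 1) * ‖x‖ ^ 2) / randersDen ε x := by
  have hq := one_sub_norm_sq_ne_zero hx
  have hD := one_sub_mul_norm_sq_ne_zero hx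
  have hD' := mul_comm (1 + ε ^ 2) _ ▸ hD
  refine gaussCurv_of_christoffel_eq_radialSymbol (alphaCoeff_eq_radialCoeff hx)
    (isUnit_det_alphaCoeff hx) (fun k i j => ((isOpen_disk ε).eventually_mem hx).mono fun _ hx' =>
      christoffel_alphaCoeff hx' k i j) (hasDerivAt_alphaSymbolP hq hD)
    (hasDerivAt_alphaSymbolQ hD) (differentiableAt_alphaSymbolR hq hD) ?_ ?_
  all_goals
    simp only [alphaIso, alphaRad, alphaSymbolP, alphaSymbolQ, alphaSymbolR, randersDen]
    field_simp
    ring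

theorem gaussCurv_alphaCoeff_zero (hx : x ∈ disk 0) : gaussCurv (alphaCoeff 0) x = -1 := by
  rw [gaussCurv_alphaCoeff hx, div_eq_iff (randersDen_pos hx).ne', randersDen]
  ring

theorem not_exists_gaussCurv_alphaCoeff_eq (hε : ε ≠ 0) :
    ¬ ∃ k : ℝ, ∀ p ∈ disk ε, gaussCurv (alphaCoeff ε) p = k := by
  rintro ⟨k, hk⟩
  obtain ⟨p, hp, (hp0 : p ≠ 0)⟩ :=
    ((((isOpen_disk ε).eventually_mem (zero_mem_disk ε)).filter_mono
      (nhdsWithin_le_nhds (s := {0}ᶜ))).and eventually_mem_nhdsWithin).exists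
  have hcurv := (hk p hp).trans (hk 0 (zero_mem_disk ε)).symm
  rw [gaussCurv_alphaCoeff hp, gaussCurv_alphaCoeff (zero_mem_disk ε),
    div_eq_iff (randersDen_pos hp).ne'] at hcurv
  have hzero : 6 * (ε ^ 2 * (1 + ε ^ 2)) * ‖p‖ ^ 2 = 0 := by
    simp only [randersDen, norm_zero] at hcurv
    linear_combination -hcurv
  exact absurd hzero (by positivity)

end AlphaCurvature

end Finsler

end

theorem theorem2 (ε : ℝ) :
    -- `F` is the unique positive solution of `Φ (y / F - ε v) = 1`
    (∀ p ∈ Finsler.disk ε, ∀ y : Finsler.Coord 2, y ≠ 0 → ∀ t : ℝ, 0 < t →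
      (Finsler.kleinNorm p (t⁻¹ • y - ε • Finsler.rot p) = 1 ↔ t = Finsler.randers ε p y)) ∧
    -- `F` is a Finsler metric, of Randers type
    Finsler.IsFinslerOn (Finsler.disk ε) (Finsler.randers ε) ∧
    Finsler.IsRandersOn (Finsler.disk ε) (Finsler.alphaCoeff ε) (Finsler.betaCoeff ε)
      (Finsler.alpha ε) (Finsler.beta ε) (Finsler.randers ε) ∧
    -- (a) `K = -1`
    Finsler.HasConstCurvatureOn (Finsler.disk ε) (Finsler.randers ε) (-1) ∧
    -- (b) `S = 0`
    (∀ p ∈ Finsler.disk ε, ∀ y : Finsler.Coord 2, y ≠ 0 →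
      Finsler.sCurv (Finsler.randers ε) p y = 0) ∧
    -- (c) not locally projectively flat
    (ε ≠ 0 → ¬ Finsler.IsLocallyProjectivelyFlatOn (Finsler.disk ε) (Finsler.randers ε)) ∧
    -- (d) the Gauss curvature of `α`
    (ε ≠ 0 → ¬ ∃ k : ℝ, ∀ p ∈ Finsler.disk ε, Finsler.gaussCurv (Finsler.alphaCoeff ε) p = k) ∧
    (ε = 0 → ∀ p ∈ Finsler.disk ε, Finsler.gaussCurv (Finsler.alphaCoeff ε) p = -1) := by
  refine ⟨fun p hp y hy t ht => Finsler.kleinNorm_eq_one_iff_eq_randers hp hy ht,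
    Finsler.isFinslerOn_randers ε, Finsler.isRandersOn_randers ε,
    Finsler.hasConstCurvatureOn_randers ε, fun p hp y hy => Finsler.sCurv_randers ⟨hp, hy⟩,
    Finsler.not_isLocallyProjectivelyFlatOn_randers, Finsler.not_exists_gaussCurv_alphaCoeff_eq, ?_⟩
  rintro rfl p hp
  exact Finsler.gaussCurv_alphaCoeff_zero hp
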